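/- For a finite set $G\subset\mathbb{R}^2\times\mathbb{R}^2$ let $$S(G)=\left\{\frac{p-q}{|p-q|} : (p,q)\in G,\ p\neq q\right\}\subset S^1$$ be the set of directions spanned by the pairs in $G$. Then the following three statements hold. (1) There are absolute constants $c,K>0$ such that the following holds. Let $P\subset\mathbb{R}^2$ be a finite set with $|P|=n\geq 2$, let $s\geq 1/2$, and let $G\subset P\times P$ satisfy $$|G|\geq n^{1+s}\quad\text{and}\quad |S(G)|\leq \frac{c\,n^{2s-1}}{\log^{12}n}.$$ Then there is a line $\ell\subset\mathbb{R}^2$ with $|\ell\cap P|\geq K\,n^{s}/\log^{4}n$. (2) (A stronger bound on the number of directions does not improve the conclusion.) There is an absolute constant $C>0$ such that the following holds. Let $1/2<s\leq 1$ and $0\leq t<2s-1$, with $t>0$ if $s=1$. Then for every sufficiently large $n\in\mathbb{N}$ (depending on $s$ and $t$) there are a set $P\subset\mathbb{R}^2$ with $|P|=n$ and a set $G\subset P\times P$ with $|G|\geq n^{1+s}$ and $|S(G)|\leq n^{t}$ such that $|\ell\cap P|\leq C n^{s}$ for every line $\ell\subset\mathbb{R}^2$. (3) (A slightly weaker bound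 on the number of directions yields at best $n^{1/2}$ collinear points.) There is an absolute constant $C>0$ such that for every $s\in[1/2,1]$ and every integer $n\geq 1$ there are a set $P\subset\mathbb{R}^2$ with $|P|=n$ and a set $G\subset P\times P$ with $|G|\geq n^{1+s}$ and $|S(G)|\leq C n^{2s-1}$ such that $|\ell\cap P|\leq C n^{1/2}$ for every line $\ell\subset\mathbb{R}^2$. -/

import Mathlib

/-- The Euclidean plane. -/
abbrev Plane : Type := EuclideanSpace ℝ (Fin 2)

/-- A line in the plane: a one-dimensional affine subspace
(this forces it to be non-empty, as the empty subspace has direction of dimension zero). -/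
def IsLine (l : AffineSubspace ℝ Plane) : Prop :=
  Module.finrank ℝ l.direction = 1

/-- The number of points of `P` on `l`. -/
noncomputable def pointsOn (l : AffineSubspace ℝ Plane) (P : Finset Plane) : ℕ :=
  ((l : Set Plane) ∩ (P : Set Plane)).ncard

/-- The set of directions `(p - q) / |p - q|` spanned by the pairs `(p, q)` in `G`. The quotient
makes sense only for `p ≠ q`; a pair `(p, p)` spans no direction. Opposite unit vectors are
different directions. -/
def directions (G : Finset (Plane × Plane)) : Set Plane :=
  {e | ∃ p q : Plane, (p, q) ∈ G ∧ p ≠ q ∧ e = ‖p - q‖⁻¹ • (p - q)}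

theorem directions_finite (G : Finset (Plane × Plane)) : (directions G).Finite := by
  refine (G.finite_toSet.image fun x : Plane × Plane => ‖x.1 - x.2‖⁻¹ • (x.1 - x.2)).subset ?_
  rintro e ⟨p, q, h, -, rfl⟩
  exact ⟨(p, q), h, rfl⟩

/-! Statement (1) is a Szemerédi–Trotter argument and loses no logarithm. Let `n` be the number of
points, `S` the set of directions, and let `k_l` be the number of points on a line `l` spanned by a
pair of `G`. Every nondegenerate pair lies on such a line, so up to the at most `n` diagonal pairs
`|G| ≤ ∑ k_l ^ 2`; at most `|S|` of the lines pass through any one point, so `∑ k_l ≤ n |S|`. Lines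
with at most `R` points contribute at most `R n |S|` to the sum of squares. Szemerédi–Trotter bounds
the contribution of the richer lines by a constant times `n ^ 2 / R + n M`, where `M = max k_l`. For
`R` a large multiple of `n ^ (1 - s)` all terms but `n M` are less than `|G|` together, so `M` is at
least a multiple of `n ^ s`. As `log n ≥ log 2`, the powers of the logarithm are absorbed by `c` and
`K`.

Szemerédi–Trotter itself follows from the crossing lemma, applied to the segments between
consecutive points on each rich line. The linear edge bound for plane drawings that it needs is
proved by charging edges to vertices, without Euler's formula.

The examples for (2) and (3) are grids. For (2), rows of length about `n ^ s` and horizontal pairs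
inside a row suffice. For (3), pairs of points of a square grid are joined along the primitive
vectors in a box of side about `n ^ (s - 1 / 2)`. -/

/-! ### The crossing lemma for drawings by segments -/

/-- A drawing of a graph with vertices `V` and edges `E` by straight segments, none of them
vertical: the edge `e` is the piece of the line `y = m e * x + b e` between its left end `a e`
and its right end `z e`, and no vertex lies in its interior. -/
structure IsSegmentDrawing {ι : Type*} (V : Finset (ℝ × ℝ)) (E : Finset ι) (a z : ι → ℝ × ℝ)
    (m b : ι → ℝ) : Prop where
  injOn : Set.InjOn Prod.fst (V : Set (ℝ × ℝ))
  left_mem : ∀ e ∈ E, a e ∈ V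
  right_mem : ∀ e ∈ E, z e ∈ V
  lt : ∀ e ∈ E, (a e).1 < (z e).1
  left_eq : ∀ e ∈ E, (a e).2 = m e * (a e).1 + b e
  right_eq : ∀ e ∈ E, (z e).2 = m e * (z e).1 + b e
  interior : ∀ e ∈ E, ∀ w ∈ V, (a e).1 < w.1 → w.1 < (z e).1 → w.2 ≠ m e * w.1 + b e

/-- Two different segments meet in a point interior to both. -/
def SegmentsCross {ι : Type*} (a z : ι → ℝ × ℝ) (m b : ι → ℝ) (e f : ι) : Prop :=
  e ≠ f ∧ ∃ x : ℝ, (a e).1 < x ∧ x < (z e).1 ∧ (a f).1 < x ∧ x < (z f).1 ∧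
    m e * x + b e = m f * x + b f

theorem exists_affine_eq {m b m' b' x y : ℝ} (hxy : x < y) (hx : m * x + b < m' * x + b')
    (hy : m' * y + b' < m * y + b) : ∃ t, x < t ∧ t < y ∧ m * t + b = m' * t + b' := by
  have hm : 0 < m - m' := by
    by_contra h
    nlinarith
  refine ⟨(b' - b) / (m - m'), ?_, ?_, ?_⟩
  · rw [lt_div_iff₀ hm]; nlinarith
  · rw [div_lt_iff₀ hm]; nlinarith
  · field_simp
    ring

/-- At most one edge per vertex is the steepest among those starting there. Any other edge `e` has a
next steeper edge `f` at its left end, and is charged to the leftmost vertex `w` in the wedge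
between the two lines. A vertex is charged at most four times: once for each answer to whether it
lies on the lower and on the upper side of the wedge. -/
theorem IsSegmentDrawing.card_le_of_not_cross {ι : Type*} {V : Finset (ℝ × ℝ)} {E : Finset ι}
    {a z : ι → ℝ × ℝ} {m b : ι → ℝ} (h : IsSegmentDrawing V E a z m b)
    (hc : ∀ e ∈ E, ∀ f ∈ E, ¬ SegmentsCross a z m b e f) : E.card ≤ 5 * V.card := by
  classical
  -- two edges with the same left end and the same slope agree
  have huniq : ∀ e ∈ E, ∀ f ∈ E, a e = a f → m e = m f → e = f := by
    intro e he f hf hef hm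
    by_contra hne
    have h1 := h.lt e he
    have h2 := h.lt f hf
    obtain ⟨x, hx1, hx2⟩ := exists_between (lt_min h1 (hef ▸ h2))
    refine hc e he f hf ⟨hne, x, hx1, (lt_min_iff.1 hx2).1, hef ▸ hx1, (lt_min_iff.1 hx2).2, ?_⟩
    have h3 := h.left_eq e he
    have h4 := h.left_eq f hf
    rw [← hef, ← hm] at h4
    rw [hm] at h3 h4 ⊢
    linarith
  set T := E.filter fun e => ∀ f ∈ E, a f = a e → m f ≤ m e with hT
  set N := E.filter fun e => ¬ ∀ f ∈ E, a f = a e → m f ≤ m e with hN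
  have hTN : T.card + N.card = E.card := Finset.card_filter_add_card_filter_not _
  have hTV : T.card ≤ V.card := by
    refine Finset.card_le_card_of_injOn a (fun e he => h.left_mem e (Finset.mem_filter.1 he).1) ?_
    intro e he f hf hef
    obtain ⟨he, he'⟩ := Finset.mem_filter.1 he
    obtain ⟨hf, hf'⟩ := Finset.mem_filter.1 hf
    exact huniq e he f hf hef (le_antisymm (hf' e he hef) (he' f hf hef.symm))
  -- the next edge `f` above `e` at the left end, and the leftmost vertex `w` between them
  have hnext : ∀ e ∈ N, ∃ f w, f ∈ E ∧ a f = a e ∧ m e < m f ∧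
      (∀ g ∈ E, a g = a e → m e < m g → m f ≤ m g) ∧ w ∈ V ∧ (a e).1 < w.1 ∧
      m e * w.1 + b e ≤ w.2 ∧ w.2 ≤ m f * w.1 + b f ∧
      (∀ v ∈ V, (a e).1 < v.1 → m e * v.1 + b e ≤ v.2 → v.2 ≤ m f * v.1 + b f → w.1 ≤ v.1) ∧
      w.1 ≤ (z e).1 ∧ w.1 ≤ (z f).1 ∧ m e * w.1 + b e < m f * w.1 + b f := by
    intro e he
    obtain ⟨he, he'⟩ := Finset.mem_filter.1 he
    push Not at he'
    obtain ⟨g, hg, hge, hgm⟩ := he'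
    obtain ⟨f, hf, hfmin⟩ := Finset.exists_min_image (E.filter fun g => a g = a e ∧ m e < m g) m
      ⟨g, by simp [hg, hge, hgm]⟩
    simp only [Finset.mem_filter] at hf hfmin
    obtain ⟨hf, hfa, hfm⟩ := hf
    have h1 := h.left_eq e he
    have h2 := h.left_eq f hf
    rw [hfa] at h2
    have hlt : ∀ x, (a e).1 < x → m e * x + b e < m f * x + b f := by
      intro x hx
      nlinarith
    have hze := h.lt e he
    have hzf := h.lt f hf
    rw [hfa] at hzf
    have hze' := h.right_eq e he
    have hzf' := h.right_eq f hf
    -- Both right ends lie in the closed wedge, so the leftmost vertex exists and neither edge ends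
    -- before reaching its abscissa.
    obtain ⟨w, hw, hwmin⟩ := Finset.exists_min_image (V.filter fun v => (a e).1 < v.1 ∧
      m e * v.1 + b e ≤ v.2 ∧ v.2 ≤ m f * v.1 + b f) Prod.fst
      ⟨z e, by
        simp only [Finset.mem_filter]
        exact ⟨h.right_mem e he, hze, hze'.ge, hze'.le.trans (hlt _ hze).le⟩⟩
    simp only [Finset.mem_filter] at hw hwmin
    obtain ⟨hwV, hw1, hw2, hw3⟩ := hw
    exact ⟨f, w, hf, hfa, hfm, fun g hg hga hgm => hfmin g ⟨hg, hga, hgm⟩, hwV, hw1, hw2, hw3,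
      fun v hv h1 h2 h3 => hwmin v ⟨hv, h1, h2, h3⟩,
      hwmin _ ⟨h.right_mem e he, hze, hze'.ge, hze'.le.trans (hlt _ hze).le⟩,
      hwmin _ ⟨h.right_mem f hf, hzf, (hlt _ hzf).le.trans hzf'.ge, hzf'.le⟩, hlt _ hw1⟩
  choose! f w hfE hfa hfm hfmin hwV hw1 hw2 hw3 hwmin hwe hwf hef using hnext
  let code : ι → (ℝ × ℝ) × Bool × Bool := fun e =>
    (w e, decide (m e * (w e).1 + b e = (w e).2), decide ((w e).2 = m (f e) * (w e).1 + b (f e)))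
  have hNE : ∀ e ∈ N, e ∈ E := fun e he => (Finset.mem_filter.1 he).1
  -- an edge starting strictly inside the strip of another one with the same code would cross it
  have hleft : ∀ e ∈ N, ∀ e' ∈ N, code e = code e' → ¬ (a e).1 < (a e').1 := by
    intro e he e' he' hcode hlt
    simp only [code, Prod.mk.injEq, decide_eq_decide] at hcode
    obtain ⟨hw, hlo, hup⟩ := hcode
    have e2 := hw2 e he
    have e3 := hw3 e he
    have e4 := hef e he
    have e5 := hwe e he
    have e6 := hwf e he
    have e1' := hw1 e' he'
    have e2' := hw2 e' he'
    have e3' := hw3 e' he'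
    have e4' := hef e' he'
    have e5' := hwe e' he'
    have e6' := hwf e' he'
    have hmin := fun h1 h2 => hwmin e he (a e') (h.left_mem e' (hNE e' he')) hlt h1 h2
    rw [← hw] at e1' e2' e3' e4' e5' e6' hlo hup
    have hl := h.left_eq e' (hNE e' he')
    have hl' := h.left_eq (f e') (hfE e' he')
    rw [hfa e' he'] at hl'
    by_cases hbelow : m e * (a e').1 + b e ≤ (a e').2
    · have habove : m (f e) * (a e').1 + b (f e) < (a e').2 := by
        by_contra hcon
        exact absurd (hmin hbelow (not_lt.1 hcon)) (not_le.2 e1')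
      -- Equality would put `w` on both `e'` and `f e`; the codes agree, so `w` would also lie on `f
      -- e'`, which is strictly above `e'` there. Hence `e'` passes from above `f e` to below it.
      have hstrict : m e' * (w e).1 + b e' < m (f e) * (w e).1 + b (f e) := by
        refine lt_of_le_of_ne (e2'.trans e3) fun hcon => ?_
        have h1 := hup.1 (by linarith)
        linarith
      obtain ⟨x, hx1, hx2, hx⟩ := exists_affine_eq e1' (hl ▸ habove) hstrict
      refine hc (f e) (hfE e he) e' (hNE e' he') ⟨?_, x, ?_, by linarith, hx1, by linarith, hx⟩
      · intro hcon
        rw [← hcon, hfa e he] at hlt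
        exact lt_irrefl _ hlt
      · rw [hfa e he]
        linarith
    · push Not at hbelow
      have hstrict : m e * (w e).1 + b e < m (f e') * (w e).1 + b (f e') := by
        refine lt_of_le_of_ne (e2.trans e3') fun hcon => ?_
        have h1 := hlo.1 (by linarith)
        linarith
      obtain ⟨x, hx1, hx2, hx⟩ := exists_affine_eq e1' (hl' ▸ hbelow) hstrict
      refine hc (f e') (hfE e' he') e (hNE e he) ⟨?_, x, ?_, by linarith, by linarith,
        by linarith, hx⟩
      · intro hcon
        rw [← hcon, hfa e' he'] at hlt
        exact lt_irrefl _ hlt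
      · rw [hfa e' he']
        exact hx1
  -- With a common left end, the wedge of `e'` lies above that of `e`. A shared `w` must then lie on
  -- `f e` and on `e'`, hence by the codes on `e`, which is impossible.
  have hslope : ∀ e ∈ N, ∀ e' ∈ N, code e = code e' → a e = a e' → ¬ m e < m e' := by
    intro e he e' he' hcode haa hlt
    simp only [code, Prod.mk.injEq, decide_eq_decide] at hcode
    obtain ⟨hw, hlo, hup⟩ := hcode
    have h1 := hfmin e he e' (hNE e' he') haa.symm hlt
    have e1 := hw1 e he
    have e3 := hw3 e he
    have e4 := hef e he
    have e2' := hw2 e' he'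
    rw [← hw] at e2' hlo hup
    have hl := h.left_eq e' (hNE e' he')
    have hl' := h.left_eq (f e) (hfE e he)
    rw [hfa e he] at hl'
    rw [← haa] at hl
    have h2 : m (f e) * (w e).1 + b (f e) ≤ m e' * (w e).1 + b e' := by nlinarith
    have h3 := hlo.2 (by linarith)
    linarith
  have hNV : N.card ≤ (V ×ˢ (Finset.univ : Finset (Bool × Bool))).card := by
    refine Finset.card_le_card_of_injOn code
      (fun e he => by simpa [code] using hwV e he) ?_
    intro e he e' he' hcode
    have hx : (a e).1 = (a e').1 :=
      le_antisymm (not_lt.1 (hleft e' he' e he hcode.symm)) (not_lt.1 (hleft e he e' he' hcode))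
    have haa := h.injOn (h.left_mem e (hNE e he)) (h.left_mem e' (hNE e' he')) hx
    exact huniq e (hNE e he) e' (hNE e' he') haa (le_antisymm
      (not_lt.1 (hslope e' he' e he hcode.symm haa.symm)) (not_lt.1 (hslope e he e' he' hcode haa)))
  rw [Finset.card_product] at hNV
  simp at hNV
  omega

/-- If each element of `V` is kept independently with probability `p`, this is the probability that
all of `T` is kept. It comes from expanding a product over `V` whose factors are `p + 0` on `T` and
`p + (1 - p)` elsewhere. The next lemma is linearity of expectation. -/
theorem sum_powerset_pow_mul_pow {α : Type*} [DecidableEq α] {V T : Finset α} (hT : T ⊆ V)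
    (p : ℝ) :
    (∑ W ∈ V.powerset with T ⊆ W, p ^ W.card * (1 - p) ^ (V \ W).card) = p ^ T.card := by
  have h := Finset.prod_add (fun _ : α => p) (fun v => if v ∈ T then 0 else 1 - p) V
  have h1 : ∏ v ∈ V, (p + if v ∈ T then 0 else 1 - p) = p ^ T.card := by
    rw [← Finset.prod_subset hT, Finset.prod_congr rfl (g := fun _ => p), Finset.prod_const]
    · intro v hv
      simp [hv]
    · intro v _ hv
      simp [hv]
  rw [← h1, h, Finset.sum_filter]
  refine Finset.sum_congr rfl fun W hW => ?_
  split_ifs with hTW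
  · rw [Finset.prod_const]
    congr 1
    rw [Finset.prod_congr rfl (g := fun _ => 1 - p), Finset.prod_const]
    intro v hv
    rw [if_neg fun hv' => (Finset.mem_sdiff.1 hv).2 (hTW hv')]
  · obtain ⟨v, hv, hvW⟩ := Finset.not_subset.1 hTW
    rw [Finset.prod_eq_zero (Finset.mem_sdiff.2 ⟨hT hv, hvW⟩) (by simp [hv]), mul_zero]

theorem sum_powerset_weight_mul_card {α κ : Type*} [DecidableEq α] {V : Finset α} (p : ℝ) (F : Finset κ)
    (T : κ → Finset α) (k : ℕ) (hF : ∀ e ∈ F, T e ⊆ V ∧ (T e).card = k) :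
    ∑ W ∈ V.powerset, p ^ W.card * (1 - p) ^ (V \ W).card *
      ((F.filter fun e => T e ⊆ W).card : ℝ) = p ^ k * F.card := by
  have : ∀ W, p ^ W.card * (1 - p) ^ (V \ W).card * ((F.filter fun e => T e ⊆ W).card : ℝ) =
      ∑ e ∈ F, if T e ⊆ W then p ^ W.card * (1 - p) ^ (V \ W).card else 0 := by
    intro W
    rw [← Finset.sum_filter, Finset.sum_const, nsmul_eq_mul, mul_comm]
  rw [Finset.sum_congr rfl fun W _ => this W, Finset.sum_comm,
    Finset.sum_congr rfl (g := fun _ => p ^ k), Finset.sum_const, nsmul_eq_mul, mul_comm]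
  intro e he
  rw [← Finset.sum_filter, sum_powerset_pow_mul_pow (hF e he).1, (hF e he).2]

-- Deleting the first edge of every crossing pair leaves a drawing without crossings.
open Classical in
theorem IsSegmentDrawing.card_le_add_card_cross {ι : Type*} {V : Finset (ℝ × ℝ)} {E : Finset ι}
    {a z : ι → ℝ × ℝ} {m b : ι → ℝ} (h : IsSegmentDrawing V E a z m b) :
    E.card ≤ 5 * V.card + ((E ×ˢ E).filter fun x => SegmentsCross a z m b x.1 x.2).card := by
  set X := (E ×ˢ E).filter fun x => SegmentsCross a z m b x.1 x.2
  have hsub : E \ X.image Prod.fst ⊆ E := Finset.sdiff_subset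
  have h' : IsSegmentDrawing V (E \ X.image Prod.fst) a z m b :=
    ⟨h.injOn, fun e he => h.left_mem e (hsub he), fun e he => h.right_mem e (hsub he),
      fun e he => h.lt e (hsub he), fun e he => h.left_eq e (hsub he),
      fun e he => h.right_eq e (hsub he), fun e he => h.interior e (hsub he)⟩
  have h1 := h'.card_le_of_not_cross fun e he f hf hef => (Finset.mem_sdiff.1 he).2
    (Finset.mem_image.2 ⟨(e, f), by simp [X, hsub he, hsub hf, hef], rfl⟩)
  have h2 := Finset.le_card_sdiff (X.image Prod.fst) E
  have h3 : (X.image Prod.fst).card ≤ X.card := Finset.card_image_le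
  omega

open Classical in
/-- The crossing lemma, before optimising the probability `p` with which vertices are kept. -/
theorem IsSegmentDrawing.crossing_lemma {ι : Type*} {V : Finset (ℝ × ℝ)} {E : Finset ι}
    {a z : ι → ℝ × ℝ} {m b : ι → ℝ} (h : IsSegmentDrawing V E a z m b)
    (hm : ∀ e ∈ E, ∀ f ∈ E, SegmentsCross a z m b e f → m e ≠ m f) {p : ℝ} (hp0 : 0 ≤ p)
    (hp1 : p ≤ 1) :
    p ^ 2 * E.card ≤ 5 * (p * V.card) +
      p ^ 4 * ((E ×ˢ E).filter fun x => SegmentsCross a z m b x.1 x.2).card := by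
  set X := (E ×ˢ E).filter fun x => SegmentsCross a z m b x.1 x.2 with hX
  let wt : Finset (ℝ × ℝ) → ℝ := fun W => p ^ W.card * (1 - p) ^ (V \ W).card
  have hwt : ∀ W, 0 ≤ wt W := fun W => mul_nonneg (pow_nonneg hp0 _)
    (pow_nonneg (sub_nonneg.2 hp1) _)
  let EW : Finset (ℝ × ℝ) → Finset ι := fun W => E.filter fun e => {a e, z e} ⊆ W
  let XW : Finset (ℝ × ℝ) → Finset (ι × ι) := fun W =>
    X.filter fun x => {a x.1, z x.1, a x.2, z x.2} ⊆ W
  -- The weaker bound is applied to the drawing induced on a random vertex set `W`. In expectation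
  -- vertices, edges and crossings scale by `p`, `p ^ 2` and `p ^ 4`, the last because the four ends
  -- of a crossing pair are distinct.
  have hmain : ∀ W ∈ V.powerset, ((EW W).card : ℝ) ≤ 5 * (W.card : ℝ) + (XW W).card := by
    intro W hW
    rw [Finset.mem_powerset] at hW
    have hsub : EW W ⊆ E := Finset.filter_subset _ _
    have hmem : ∀ e ∈ EW W, a e ∈ W ∧ z e ∈ W := by
      intro e he
      have := (Finset.mem_filter.1 he).2
      simpa [Finset.insert_subset_iff] using this
    have h' : IsSegmentDrawing W (EW W) a z m b :=
      ⟨h.injOn.mono (by exact_mod_cast hW), fun e he => (hmem e he).1, fun e he => (hmem e he).2,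
        fun e he => h.lt e (hsub he), fun e he => h.left_eq e (hsub he),
        fun e he => h.right_eq e (hsub he), fun e he w hw => h.interior e (hsub he) w (hW hw)⟩
    have h1 := h'.card_le_add_card_cross
    have h2 : ((EW W ×ˢ EW W).filter fun x => SegmentsCross a z m b x.1 x.2) ⊆ XW W := by
      intro x hx
      obtain ⟨hx, hx'⟩ := Finset.mem_filter.1 hx
      obtain ⟨he, hf⟩ := Finset.mem_product.1 hx
      refine Finset.mem_filter.2 ⟨Finset.mem_filter.2
        ⟨Finset.mem_product.2 ⟨hsub he, hsub hf⟩, hx'⟩, ?_⟩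
      simp [Finset.insert_subset_iff, hmem _ he, hmem _ hf]
    have h3 := Finset.card_le_card h2
    exact_mod_cast h1.trans (by omega)
  have hE := sum_powerset_weight_mul_card (V := V) p E (fun e => {a e, z e}) 2 fun e he => by
    refine ⟨by simp [Finset.insert_subset_iff, h.left_mem e he, h.right_mem e he], ?_⟩
    exact Finset.card_pair fun hcon => (h.lt e he).ne (by rw [hcon])
  have hXc := sum_powerset_weight_mul_card (V := V) p X (fun x => {a x.1, z x.1, a x.2, z x.2}) 4 fun x hx => by
    obtain ⟨hx, hx'⟩ := Finset.mem_filter.1 hx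
    obtain ⟨he, hf⟩ := Finset.mem_product.1 hx
    have hmm := hm _ he _ hf hx'
    obtain ⟨-, t, h1, h2, h3, h4, h5⟩ := hx'
    refine ⟨by simp [Finset.insert_subset_iff, h.left_mem _ he, h.right_mem _ he,
      h.left_mem _ hf, h.right_mem _ hf], ?_⟩
    have n1 : a x.1 ≠ z x.1 := fun hcon => (h.lt _ he).ne (by rw [hcon])
    have n2 : a x.2 ≠ z x.2 := fun hcon => (h.lt _ hf).ne (by rw [hcon])
    have n3 : a x.1 ≠ z x.2 := fun hcon => by rw [hcon] at h1; linarith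
    have n4 : z x.1 ≠ a x.2 := fun hcon => by rw [hcon] at h2; linarith
    -- Two lines of different slopes that meet above `t` meet nowhere else, so the edges share no
    -- end.
    have key : ∀ s, s ≠ t → m x.1 * s + b x.1 = m x.2 * s + b x.2 → False := by
      intro s hs hst
      have : (m x.1 - m x.2) * (s - t) = 0 := by linarith
      rcases mul_eq_zero.1 this with h | h
      · exact hmm (sub_eq_zero.1 h)
      · exact hs (sub_eq_zero.1 h)
    have n5 : a x.1 ≠ a x.2 := fun hcon => key _ h1.ne (by
      rw [← h.left_eq _ he, hcon, ← h.left_eq _ hf])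
    have n6 : z x.1 ≠ z x.2 := fun hcon => key _ h2.ne' (by
      rw [← h.right_eq _ he, hcon, ← h.right_eq _ hf])
    rw [Finset.card_insert_of_notMem (by simp [n1, n3, n5]),
      Finset.card_insert_of_notMem (by simp [n4, n6]), Finset.card_pair n2]
  have hV := sum_powerset_weight_mul_card (V := V) p V (fun v => {v}) 1 fun v hv => by simpa using hv
  have hV' : ∑ W ∈ V.powerset, wt W * (W.card : ℝ) = p ^ 1 * V.card := by
    rw [← hV]
    refine Finset.sum_congr rfl fun W hW => ?_
    simp only [wt]
    refine congrArg (fun S : Finset (ℝ × ℝ) => wt W * (S.card : ℝ)) ?_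
    ext v
    have := @Finset.mem_powerset.1 hW v
    simp only [Finset.mem_filter, Finset.singleton_subset_iff]
    tauto
  have hsum := Finset.sum_le_sum fun W hW => mul_le_mul_of_nonneg_left (hmain W hW) (hwt W)
  simp only [mul_add, Finset.sum_add_distrib] at hsum
  simp only [EW, XW, wt] at hsum
  rw [hE, hXc] at hsum
  have h5 : ∑ W ∈ V.powerset, wt W * (5 * (W.card : ℝ)) = 5 * (p * V.card) := by
    simp only [pow_one, wt] at hV'
    rw [← hV', Finset.mul_sum]
    exact Finset.sum_congr rfl fun W _ => by ring
  rw [h5] at hsum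
  exact hsum

/-! ### The Szemerédi–Trotter bound and sums of squares -/

open Classical in
/-- The points of `V` on the line `y = l.1 * x + l.2`. -/
noncomputable def onGraph (V : Finset (ℝ × ℝ)) (l : ℝ × ℝ) : Finset (ℝ × ℝ) :=
  V.filter fun v => v.2 = l.1 * v.1 + l.2

theorem mem_onGraph {V : Finset (ℝ × ℝ)} {l v : ℝ × ℝ} :
    v ∈ onGraph V l ↔ v ∈ V ∧ v.2 = l.1 * v.1 + l.2 := by
  simp [onGraph]

/-- Here `k` is the number of lines, each with at least `r` of the `n` points, `e` that of edges and
`x` that of crossings. The choice of `p` makes the edge term at least twice the vertex term, so the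
crossing term must dominate. -/
theorem mul_pow_three_le_of_crossing {n k r e x : ℝ} (hn : 0 < n) (hr : 0 ≤ r)
    (hcase : 20 * n < k * r) (he : k * r / 2 ≤ e) (hx : x ≤ k ^ 2)
    (h : ∀ p : ℝ, 0 ≤ p → p ≤ 1 → p ^ 2 * e ≤ 5 * (p * n) + p ^ 4 * x) :
    k * r ^ 3 ≤ 1600 * n ^ 2 := by
  have hkr : 0 < k * r := by linarith
  have hk0 : 0 < k := pos_of_mul_pos_left hkr hr
  set p : ℝ := 20 * n / (k * r) with hp
  have hp0 : 0 < p := by positivity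
  have hpq : p * (k * r) = 20 * n := by
    rw [hp, div_mul_cancel₀ _ hkr.ne']
  have h1 : p ^ 2 * (k * r / 2) ≤ 5 * (p * n) + p ^ 4 * k ^ 2 :=
    le_trans (by gcongr) ((h p hp0.le ((div_le_one hkr).2 hcase.le)).trans (by gcongr))
  have h2 : p ^ 2 * (k * r / 2) = 10 * (p * n) := by
    rw [sq, mul_assoc, mul_div_assoc', hpq]
    ring
  have h3 : p * (5 * n) ≤ p * (p ^ 3 * k ^ 2) := by nlinarith
  have h4 : 5 * n ≤ p ^ 3 * k ^ 2 := le_of_mul_le_mul_left h3 hp0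
  have h5 : 5 * n * (k * r ^ 3) ≤ 5 * n * (1600 * n ^ 2) := by
    calc 5 * n * (k * r ^ 3) ≤ p ^ 3 * k ^ 2 * (k * r ^ 3) := by gcongr
      _ = (p * (k * r)) ^ 3 := by ring
      _ = _ := by rw [hpq]; ring
  exact le_of_mul_le_mul_left h5 (by positivity)

/-- The Szemerédi–Trotter bound for the number of lines that contain at least `r` points. -/
theorem szemeredi_trotter_rich {V L : Finset (ℝ × ℝ)}
    (hinj : Set.InjOn Prod.fst (V : Set (ℝ × ℝ))) {r : ℕ} (hr : 2 ≤ r)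
    (hL : ∀ l ∈ L, r ≤ (onGraph V l).card) :
    (L.card : ℝ) * r ≤ 20 * V.card ∨ (L.card : ℝ) * r ^ 3 ≤ 1600 * V.card ^ 2 := by
  classical
  -- An edge is a line with one of its points other than the last; it runs to the next point `z` on
  -- that line.
  set E : Finset ((ℝ × ℝ) × (ℝ × ℝ)) := (L ×ˢ V).filter fun e =>
    e.2 ∈ onGraph V e.1 ∧ ∃ w ∈ onGraph V e.1, e.2.1 < w.1 with hE
  have hnext : ∀ e ∈ E, ∃ z ∈ onGraph V e.1, e.2.1 < z.1 ∧
      ∀ w ∈ onGraph V e.1, e.2.1 < w.1 → z.1 ≤ w.1 := by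
    intro e he
    obtain ⟨-, -, w, hw, hw'⟩ := Finset.mem_filter.1 he
    obtain ⟨z, hz, hmin⟩ := Finset.exists_min_image
      ((onGraph V e.1).filter fun w => e.2.1 < w.1) Prod.fst ⟨w, by simp [hw, hw']⟩
    simp only [Finset.mem_filter] at hz hmin
    exact ⟨z, hz.1, hz.2, fun w hw hw' => hmin w ⟨hw, hw'⟩⟩
  choose! z hzl hzlt hzmin using hnext
  have hEl : ∀ e ∈ E, e.2 ∈ onGraph V e.1 := fun e he => (Finset.mem_filter.1 he).2.1
  have hEL : ∀ e ∈ E, e.1 ∈ L := fun e he =>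
    (Finset.mem_product.1 (Finset.mem_filter.1 he).1).1
  have hdraw : IsSegmentDrawing V E Prod.snd z (fun e => e.1.1) (fun e => e.1.2) :=
    ⟨hinj, fun e he => (mem_onGraph.1 (hEl e he)).1, fun e he => (mem_onGraph.1 (hzl e he)).1,
      hzlt, fun e he => (mem_onGraph.1 (hEl e he)).2, fun e he => (mem_onGraph.1 (hzl e he)).2,
      fun e he w hw h1 h2 h3 => absurd (hzmin e he w (mem_onGraph.2 ⟨hw, h3⟩) h1) (not_le.2 h2)⟩
  have hover : ∀ e ∈ E, ∀ f ∈ E, e.1 = f.1 → ∀ x, e.2.1 < x → x < (z e).1 → f.2.1 < x →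
      x < (z f).1 → e = f := by
    have aux : ∀ e ∈ E, ∀ f ∈ E, e.1 = f.1 → ∀ x, x < (z e).1 → f.2.1 < x →
        f.2.1 ≤ e.2.1 := by
      intro e he f hf hef x h2 h3
      by_contra hcon
      have := hzmin e he f.2 (hef ▸ hEl f hf) (not_le.1 hcon)
      linarith
    intro e he f hf hef x h1 h2 h3 h4
    refine Prod.ext hef (hinj ?_ ?_ (le_antisymm (aux f hf e he hef.symm x h4 h1)
      (aux e he f hf hef x h2 h3)))
    exacts [(mem_onGraph.1 (hEl e he)).1, (mem_onGraph.1 (hEl f hf)).1]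
  have hslope : ∀ e ∈ E, ∀ f ∈ E, SegmentsCross Prod.snd z (fun e => e.1.1) (fun e => e.1.2) e f →
      e.1.1 ≠ f.1.1 := by
    rintro e he f hf ⟨hne, x, h1, h2, h3, h4, h5⟩ hm
    refine hne (hover e he f hf (Prod.ext hm ?_) x h1 h2 h3 h4)
    simp only [hm] at h5
    linarith
  set X := (E ×ˢ E).filter fun x =>
    SegmentsCross Prod.snd z (fun e => e.1.1) (fun e => e.1.2) x.1 x.2 with hX
  -- Two lines meet at one point, and edges on one line have disjoint interiors, so a crossing is
  -- determined by its two lines.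
  have hXL : X.card ≤ L.card * L.card := by
    rw [← Finset.card_product]
    refine Finset.card_le_card_of_injOn (fun x => (x.1.1, x.2.1)) ?_ ?_
    · intro x hx
      obtain ⟨he, hf⟩ := Finset.mem_product.1 (Finset.mem_filter.1 hx).1
      simp [hEL _ he, hEL _ hf]
    · rintro ⟨e, f⟩ hx ⟨e', f'⟩ hx' hl
      obtain ⟨h, hc⟩ := Finset.mem_filter.1 hx
      obtain ⟨he, hf⟩ := Finset.mem_product.1 h
      obtain ⟨h', hc'⟩ := Finset.mem_filter.1 hx'
      obtain ⟨he', hf'⟩ := Finset.mem_product.1 h'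
      simp only [Prod.mk.injEq] at hl
      have hm := hslope _ he _ hf hc
      obtain ⟨-, x, h1, h2, h3, h4, h5⟩ := hc
      obtain ⟨-, x', h1', h2', h3', h4', h5'⟩ := hc'
      simp only [← hl.1, ← hl.2] at h5'
      simp only at h1 h2 h3 h4 h5 h1' h2' h3' h4' h5' hm he hf he' hf'
      have hxx : x = x' := by
        have : (e.1.1 - f.1.1) * (x - x') = 0 := by linarith
        rcases mul_eq_zero.1 this with h | h
        · exact absurd (sub_eq_zero.1 h) hm
        · exact sub_eq_zero.1 h
      subst hxx
      rw [hover e he e' he' hl.1 x h1 h2 h1' h2', hover f hf f' hf' hl.2 x h3 h4 h3' h4']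
  have hEcard : L.card * (r - 1) ≤ E.card := by
    have : E.card = ∑ l ∈ L, (V.filter fun v =>
        v ∈ onGraph V l ∧ ∃ w ∈ onGraph V l, v.1 < w.1).card := by
      simp only [hE, Finset.card_filter, Finset.sum_product]
    rw [this, ← smul_eq_mul, ← Finset.sum_const]
    refine Finset.sum_le_sum fun l hl => ?_
    have hrl := hL l hl
    obtain ⟨t, ht, hmax⟩ := Finset.exists_max_image (onGraph V l) Prod.fst
      (Finset.card_pos.1 (by omega))
    have hsub : (onGraph V l).erase t ⊆ V.filter fun v =>
        v ∈ onGraph V l ∧ ∃ w ∈ onGraph V l, v.1 < w.1 := by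
      intro v hv
      obtain ⟨hvt, hv⟩ := Finset.mem_erase.1 hv
      refine Finset.mem_filter.2 ⟨(mem_onGraph.1 hv).1, hv, t, ht, ?_⟩
      exact lt_of_le_of_ne (hmax v hv) fun hcon =>
        hvt (hinj (mem_onGraph.1 hv).1 (mem_onGraph.1 ht).1 hcon)
    have h1 := Finset.card_le_card hsub
    rw [Finset.card_erase_of_mem ht] at h1
    omega
  have hEreal : (L.card : ℝ) * r / 2 ≤ E.card := by
    have h1 : L.card * r ≤ 2 * E.card := by
      have : r ≤ 2 * (r - 1) := by omega
      nlinarith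
    have : (L.card : ℝ) * r ≤ 2 * E.card := by exact_mod_cast h1
    linarith
  have hXreal : (X.card : ℝ) ≤ (L.card : ℝ) ^ 2 := by
    rw [sq]
    exact_mod_cast hXL
  by_cases hcase : (L.card : ℝ) * r ≤ 20 * V.card
  · exact Or.inl hcase
  right
  push Not at hcase
  rcases V.eq_empty_or_nonempty with rfl | hV
  · have hk0 : L = ∅ := by
      rw [Finset.eq_empty_iff_forall_notMem]
      intro l hl
      have h1 := hL l hl
      have h2 : (onGraph ∅ l).card ≤ 0 := Finset.card_filter_le _ _
      omega
    simp [hk0]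
  · exact mul_pow_three_le_of_crossing (by exact_mod_cast hV.card_pos)
      (Nat.cast_nonneg _) hcase hEreal hXreal
      fun p hp0 hp1 => hdraw.crossing_lemma hslope hp0 hp1

theorem sq_le_mul_add_sum {R M k : ℕ} (hk : k ≤ M) :
    k ^ 2 ≤ R * k + ∑ r ∈ Finset.Ioc R M, if r ≤ k then 2 * r else 0 := by
  rcases le_total k R with h | h
  · exact (by nlinarith : k ^ 2 ≤ R * k).trans (Nat.le_add_right _ _)
  have h1 : ∀ j, R ≤ j → j ^ 2 ≤ R * R + ∑ r ∈ Finset.Ioc R j, 2 * r := by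
    intro j hj
    induction j, hj using Nat.le_induction with
    | base => simp [sq]
    | succ j hj ih =>
      rw [← Finset.insert_Ioc_right_eq_Ioc_add_one hj, Finset.sum_insert (by simp)]
      nlinarith
  have h2 : ∑ r ∈ Finset.Ioc R k, 2 * r ≤
      ∑ r ∈ Finset.Ioc R M, if r ≤ k then 2 * r else 0 := by
    rw [← Finset.sum_filter]
    refine Finset.sum_le_sum_of_subset fun r hr => ?_
    simp only [Finset.mem_Ioc, Finset.mem_filter] at hr ⊢
    omega
  have h3 := h1 k h
  nlinarith

/-- The squares are summed by layers: `k ^ 2` is at most `R * k` plus the sum of `2 * r` over `R < r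
≤ k`. The number of lines with at least `r` points is then bounded by Szemerédi–Trotter, whose two
alternatives give the last two terms. -/
theorem sum_sq_card_onGraph_le {V L : Finset (ℝ × ℝ)}
    (hinj : Set.InjOn Prod.fst (V : Set (ℝ × ℝ))) {R M : ℕ} (hR : 1 ≤ R)
    (hM : ∀ l ∈ L, (onGraph V l).card ≤ M) :
    ∑ l ∈ L, ((onGraph V l).card : ℝ) ^ 2 ≤ R * ∑ l ∈ L, ((onGraph V l).card : ℝ) +
      3200 * (V.card : ℝ) ^ 2 / R + 40 * V.card * M := by
  classical
  have hR0 : (0 : ℝ) < R := by exact_mod_cast hR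
  have h1 : ∑ l ∈ L, ((onGraph V l).card : ℝ) ^ 2 ≤ R * ∑ l ∈ L, ((onGraph V l).card : ℝ) +
      ∑ r ∈ Finset.Ioc R M, 2 * (r : ℝ) * (L.filter fun l => r ≤ (onGraph V l).card).card := by
    have h2 : ∀ r ∈ Finset.Ioc R M,
        2 * (r : ℝ) * (L.filter fun l => r ≤ (onGraph V l).card).card =
          ∑ l ∈ L, if r ≤ (onGraph V l).card then 2 * (r : ℝ) else 0 := by
      intro r _
      rw [← Finset.sum_filter, Finset.sum_const, nsmul_eq_mul, mul_comm]
    rw [Finset.sum_congr rfl h2, Finset.sum_comm, Finset.mul_sum, ← Finset.sum_add_distrib]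
    refine Finset.sum_le_sum fun l hl => ?_
    exact_mod_cast sq_le_mul_add_sum (R := R) (hM l hl)
  have h2 : ∀ r ∈ Finset.Ioc R M,
      2 * (r : ℝ) * (L.filter fun l => r ≤ (onGraph V l).card).card ≤
        40 * V.card + 3200 * (V.card : ℝ) ^ 2 * ((r : ℝ) ^ 2)⁻¹ := by
    intro r hr
    have hr' := Finset.mem_Ioc.1 hr
    have hr0 : (0 : ℝ) < r := by exact_mod_cast (by omega : 0 < r)
    rcases szemeredi_trotter_rich (L := L.filter fun l => r ≤ (onGraph V l).card) hinj
      (r := r) (by omega) (fun l hl => (Finset.mem_filter.1 hl).2) with h | h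
    · have : 0 ≤ 3200 * (V.card : ℝ) ^ 2 * ((r : ℝ) ^ 2)⁻¹ := by positivity
      linarith
    · have h3 : 2 * (r : ℝ) * (L.filter fun l => r ≤ (onGraph V l).card).card ≤
          3200 * (V.card : ℝ) ^ 2 * ((r : ℝ) ^ 2)⁻¹ := by
        rw [← div_eq_mul_inv, le_div_iff₀ (by positivity)]
        linarith
      have : (0 : ℝ) ≤ 40 * V.card := by positivity
      linarith
  have h3 : ∑ r ∈ Finset.Ioc R M, (40 * (V.card : ℝ) +
      3200 * (V.card : ℝ) ^ 2 * ((r : ℝ) ^ 2)⁻¹) ≤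
        3200 * (V.card : ℝ) ^ 2 / R + 40 * V.card * M := by
    rcases le_total R M with h | h
    · rw [Finset.sum_add_distrib, ← Finset.mul_sum (Finset.Ioc R M) _ (3200 * (V.card : ℝ) ^ 2),
        Finset.sum_const, Nat.card_Ioc, nsmul_eq_mul]
      have h4 := sum_Ioc_inv_sq_le_sub (α := ℝ) (by omega : R ≠ 0) h
      have h5 : ∑ r ∈ Finset.Ioc R M, ((r : ℝ) ^ 2)⁻¹ ≤ (R : ℝ)⁻¹ := by
        have : (0 : ℝ) ≤ (M : ℝ)⁻¹ := by positivity
        linarith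
      have h6 : ((M - R : ℕ) : ℝ) ≤ M := by exact_mod_cast Nat.sub_le M R
      have h7 : ((M - R : ℕ) : ℝ) * (40 * V.card) ≤ M * (40 * V.card) := by gcongr
      have h8 : 3200 * (V.card : ℝ) ^ 2 * ∑ r ∈ Finset.Ioc R M, ((r : ℝ) ^ 2)⁻¹ ≤
          3200 * (V.card : ℝ) ^ 2 * (R : ℝ)⁻¹ := by gcongr
      rw [div_eq_mul_inv]
      linarith
    · rw [Finset.Ioc_eq_empty (by omega), Finset.sum_empty]
      positivity
  linarith [Finset.sum_le_sum h2]

/-! ### From few directions to a rich line -/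

/-- The slope and the intercept of the line through two points. -/
noncomputable def graphThrough (x : (ℝ × ℝ) × (ℝ × ℝ)) : ℝ × ℝ :=
  ((x.1.2 - x.2.2) / (x.1.1 - x.2.1),
    x.1.2 - (x.1.2 - x.2.2) / (x.1.1 - x.2.1) * x.1.1)

theorem exists_rich_graphThrough {V : Finset (ℝ × ℝ)} {G : Finset ((ℝ × ℝ) × (ℝ × ℝ))}
    {S : Finset ℝ} (hinj : Set.InjOn Prod.fst (V : Set (ℝ × ℝ))) (hG : G ⊆ V ×ˢ V)
    (hne : ∀ x ∈ G, x.1 ≠ x.2) (hS : ∀ x ∈ G, (graphThrough x).1 ∈ S) (hG0 : G.Nonempty)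
    {R : ℕ} (hR : 1 ≤ R) :
    ∃ x ∈ G, (G.card : ℝ) ≤ R * (V.card * S.card) + 3200 * (V.card : ℝ) ^ 2 / R +
      40 * V.card * (onGraph V (graphThrough x)).card := by
  classical
  obtain ⟨x, hx, hmax⟩ := Finset.exists_max_image G (fun x => (onGraph V (graphThrough x)).card) hG0
  refine ⟨x, hx, ?_⟩
  set L := G.image graphThrough with hL
  have h1 := sum_sq_card_onGraph_le (L := L) hinj hR
    (M := (onGraph V (graphThrough x)).card) (by
      intro l hl
      obtain ⟨y, hy, rfl⟩ := Finset.mem_image.1 hl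
      exact hmax y hy)
  -- The pairs of `G` that span `l` are pairs of points on `l`.
  have h2 : G.card ≤ ∑ l ∈ L, (onGraph V l).card ^ 2 := by
    rw [Finset.card_eq_sum_card_fiberwise (f := graphThrough) (t := L)
      (fun y hy => Finset.mem_image_of_mem _ hy)]
    refine Finset.sum_le_sum fun l _ => ?_
    rw [sq, ← Finset.card_product]
    refine Finset.card_le_card fun y hy' => ?_
    obtain ⟨hy, rfl⟩ := Finset.mem_filter.1 hy'
    obtain ⟨hp, hq⟩ := Finset.mem_product.1 (hG hy)
    have hxne : y.1.1 - y.2.1 ≠ 0 := fun h => hne y hy (hinj hp hq (sub_eq_zero.1 h))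
    refine Finset.mem_product.2 ⟨mem_onGraph.2 ⟨hp, ?_⟩, mem_onGraph.2 ⟨hq, ?_⟩⟩
    · simp [graphThrough]
    · simp only [graphThrough]
      field_simp
      ring
  -- Double counting of incidences: a line through a given point is determined by its slope.
  have h3 : ∑ l ∈ L, (onGraph V l).card ≤ V.card * S.card := by
    have : ∑ l ∈ L, (onGraph V l).card =
        ∑ v ∈ V, (L.filter fun l => v.2 = l.1 * v.1 + l.2).card := by
      simp only [onGraph, Finset.card_filter]
      exact Finset.sum_comm
    rw [this, ← smul_eq_mul]
    refine Finset.sum_le_card_nsmul _ _ _ fun v _ => ?_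
    refine Finset.card_le_card_of_injOn Prod.fst ?_ ?_
    · intro l hl
      obtain ⟨y, hy, rfl⟩ := Finset.mem_image.1 (Finset.mem_filter.1 hl).1
      exact hS y hy
    · intro l hl l' hl' hll
      have e1 := (Finset.mem_filter.1 hl).2
      have e2 := (Finset.mem_filter.1 hl').2
      refine Prod.ext hll ?_
      rw [hll] at e1
      linarith
  have h2' : (G.card : ℝ) ≤ ∑ l ∈ L, ((onGraph V l).card : ℝ) ^ 2 := by exact_mod_cast h2
  have h3' : ∑ l ∈ L, ((onGraph V l).card : ℝ) ≤ V.card * S.card := by exact_mod_cast h3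
  have h4 : R * ∑ l ∈ L, ((onGraph V l).card : ℝ) ≤ R * ((V.card : ℝ) * S.card) := by gcongr
  linarith

/-- Only finitely many shears make two given points share an abscissa. A good shear removes vertical
lines while preserving collinearity. -/
theorem exists_injOn_shear (P : Finset Plane) :
    ∃ t : ℝ, Set.InjOn (fun p : Plane => p 0 + t * p 1) (P : Set Plane) := by
  classical
  obtain ⟨t, ht⟩ := Infinite.exists_notMem_finset
    ((P ×ˢ P).image fun x => -(x.1 0 - x.2 0) / (x.1 1 - x.2 1))
  refine ⟨t, fun p hp q hq hpq => ?_⟩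
  simp only at hpq
  have h1 : p 1 = q 1 := by
    by_contra hne
    refine ht (Finset.mem_image.2 ⟨(p, q), Finset.mem_product.2 ⟨hp, hq⟩, ?_⟩)
    rw [div_eq_iff (sub_ne_zero.2 hne)]
    linarith
  have h0 : p 0 = q 0 := by
    rw [h1] at hpq
    linarith
  ext i
  fin_cases i <;> assumption

theorem isLine_affineSpan_pair {p q : Plane} (hpq : p ≠ q) : IsLine line[ℝ, p, q] := by
  rw [IsLine, direction_affineSpan, vectorSpan_eq_span_vsub_set_right ℝ (Set.mem_insert p {q}),
    Set.image_pair, vsub_self, Submodule.span_insert_zero]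
  exact finrank_span_singleton (vsub_ne_zero.2 hpq.symm)

theorem exists_rich_line {P : Finset Plane} {G : Finset (Plane × Plane)} (hG : G ⊆ P ×ˢ P)
    (hcard : P.card < G.card) {R : ℕ} (hR : 1 ≤ R) :
    ∃ l : AffineSubspace ℝ Plane, IsLine l ∧
      (G.card : ℝ) ≤ P.card + R * (P.card * (directions G).ncard) +
        3200 * (P.card : ℝ) ^ 2 / R + 40 * P.card * pointsOn l P := by
  classical
  obtain ⟨t, ht⟩ := exists_injOn_shear P
  let φ : Plane → ℝ × ℝ := fun p => (p 0 + t * p 1, p 1)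
  have hφ : Set.InjOn φ (P : Set Plane) := fun p hp q hq hpq => ht hp hq (congrArg Prod.fst hpq)
  set V := P.image φ with hV
  have hVc : V.card = P.card := Finset.card_image_of_injOn hφ
  have hinj : Set.InjOn Prod.fst (V : Set (ℝ × ℝ)) := by
    intro v hv w hw hvw
    obtain ⟨p, hp, rfl⟩ := Finset.mem_image.1 hv
    obtain ⟨q, hq, rfl⟩ := Finset.mem_image.1 hw
    exact congrArg φ (ht hp hq hvw)
  set G₁ := G.filter fun x => x.1 ≠ x.2 with hG₁
  set G₂ := G₁.image (Prod.map φ φ) with hG₂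
  have hmemP : ∀ x ∈ G₁, x.1 ∈ P ∧ x.2 ∈ P := fun x hx =>
    Finset.mem_product.1 (hG (Finset.mem_filter.1 hx).1)
  have hG₂c : G₂.card = G₁.card := by
    refine Finset.card_image_of_injOn fun x hx y hy hxy => ?_
    exact Prod.ext (hφ (hmemP x hx).1 (hmemP y hy).1 (congrArg Prod.fst hxy))
      (hφ (hmemP x hx).2 (hmemP y hy).2 (congrArg Prod.snd hxy))
  have hG₁c : G.card ≤ G₁.card + P.card := by
    have h1 : G₁.card + (G.filter fun x => ¬ x.1 ≠ x.2).card = G.card :=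
      Finset.card_filter_add_card_filter_not _
    have h2 : (G.filter fun x => ¬ x.1 ≠ x.2).card ≤ P.card := by
      refine Finset.card_le_card_of_injOn Prod.fst
        (fun x hx => (Finset.mem_product.1 (hG (Finset.mem_filter.1 hx).1)).1) ?_
      intro x hx y hy hxy
      have e1 := not_not.1 (Finset.mem_filter.1 hx).2
      have e2 := not_not.1 (Finset.mem_filter.1 hy).2
      exact Prod.ext hxy (by rw [← e1, ← e2, hxy])
    omega
  -- The slope after the shear depends only on the direction before it.
  let S := (directions_finite G).toFinset.image fun e : Plane => e 1 / (e 0 + t * e 1)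
  have hSc : S.card ≤ (directions G).ncard := by
    rw [Set.ncard_eq_toFinset_card _ (directions_finite G)]
    exact Finset.card_image_le
  obtain ⟨y, hy, hle⟩ := exists_rich_graphThrough (V := V) (G := G₂) (S := S) hinj
    (by
      intro y hy
      obtain ⟨x, hx, rfl⟩ := Finset.mem_image.1 hy
      exact Finset.mem_product.2 ⟨Finset.mem_image_of_mem _ (hmemP x hx).1,
        Finset.mem_image_of_mem _ (hmemP x hx).2⟩)
    (by
      intro y hy
      obtain ⟨x, hx, rfl⟩ := Finset.mem_image.1 hy
      exact fun hcon => (Finset.mem_filter.1 hx).2 (hφ (hmemP x hx).1 (hmemP x hx).2 hcon))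
    (by
      intro y hy
      obtain ⟨x, hx, rfl⟩ := Finset.mem_image.1 hy
      obtain ⟨hx, hne⟩ := Finset.mem_filter.1 hx
      refine Finset.mem_image.2 ⟨‖x.1 - x.2‖⁻¹ • (x.1 - x.2), ?_, ?_⟩
      · rw [Set.Finite.mem_toFinset]
        exact ⟨x.1, x.2, hx, hne, rfl⟩
      · have h0 : ‖x.1 - x.2‖ ≠ 0 := norm_ne_zero_iff.2 (sub_ne_zero.2 hne)
        simp only [graphThrough, φ, Prod.map, PiLp.smul_apply, PiLp.sub_apply, smul_eq_mul]
        rw [← mul_div_mul_left (x.1 1 - x.2 1) _ (inv_ne_zero h0)]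
        congr 1
        ring)
    (Finset.card_pos.1 (by omega)) hR
  obtain ⟨x, hx, rfl⟩ := Finset.mem_image.1 hy
  have hne := (Finset.mem_filter.1 hx).2
  refine ⟨line[ℝ, x.1, x.2], isLine_affineSpan_pair hne, ?_⟩
  have hpts : (onGraph V (graphThrough (Prod.map φ φ x))).card ≤
      pointsOn line[ℝ, x.1, x.2] P := by
    have hfin : ((line[ℝ, x.1, x.2] : Set Plane) ∩ (P : Set Plane)).Finite :=
      P.finite_toSet.inter_of_right _
    rw [pointsOn, Set.ncard_eq_toFinset_card _ hfin]
    refine (Finset.card_le_card fun v hv => ?_).trans (Finset.card_image_le (f := φ))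
    obtain ⟨hv, hvl⟩ := mem_onGraph.1 hv
    obtain ⟨w, hw, rfl⟩ := Finset.mem_image.1 hv
    refine Finset.mem_image_of_mem _ ?_
    rw [Set.Finite.mem_toFinset]
    refine ⟨?_, hw⟩
    have hd : (φ x.1).1 - (φ x.2).1 ≠ 0 :=
      fun h => hne (ht (hmemP x hx).1 (hmemP x hx).2 (sub_eq_zero.1 h))
    set τ : ℝ := ((φ x.1).1 - (φ w).1) / ((φ x.1).1 - (φ x.2).1) with hτ
    have hτ' : τ * ((φ x.1).1 - (φ x.2).1) = (φ x.1).1 - (φ w).1 := div_mul_cancel₀ _ hd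
    clear_value τ
    have h1 : w 1 = x.1 1 + τ * (x.2 1 - x.1 1) := by
      have e' : ∀ A B D : ℝ, D ≠ 0 → A - (A - B) / D * (τ * D) = A + τ * (B - A) := by
        intro A B D hD
        field_simp
        ring
      have : w 1 = (φ x.1).2 - ((φ x.1).2 - (φ x.2).2) / ((φ x.1).1 - (φ x.2).1) *
          ((φ x.1).1 - (φ w).1) := by
        have e : w 1 = (φ w).2 := rfl
        rw [e, hvl]
        simp only [graphThrough, Prod.map]
        ring
      rw [this, ← hτ', e' _ _ _ hd]
    have h0 : w 0 = x.1 0 + τ * (x.2 0 - x.1 0) := by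
      simp only [φ] at hτ'
      linear_combination hτ' - t * h1
    have hw' : w = AffineMap.lineMap x.1 x.2 τ := by
      ext i
      fin_cases i
      · simp [AffineMap.lineMap_apply, h0]; ring
      · simp [AffineMap.lineMap_apply, h1]; ring
    rw [hw']
    exact AffineMap.lineMap_mem_affineSpan_pair τ x.1 x.2
  rw [hVc, hG₂c] at hle
  have h1 : (G.card : ℝ) ≤ G₁.card + P.card := by exact_mod_cast hG₁c
  have h2 : (R : ℝ) * (P.card * S.card) ≤ R * (P.card * (directions G).ncard) := by gcongr
  have h3 : 40 * (P.card : ℝ) * (onGraph V (graphThrough (Prod.map φ φ x))).card ≤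
      40 * P.card * pointsOn line[ℝ, x.1, x.2] P := by gcongr
  linarith

theorem exists_line_of_few_directions :
    ∃ c : ℝ, 0 < c ∧ ∃ K : ℝ, 0 < K ∧
      ∀ (n : ℕ) (s : ℝ) (P : Finset Plane) (G : Finset (Plane × Plane)),
        2 ≤ n → P.card = n → 1 / 2 ≤ s → G ⊆ P ×ˢ P →
        (n : ℝ) ^ (1 + s) ≤ (G.card : ℝ) →
        ((directions G).ncard : ℝ) ≤ c * (n : ℝ) ^ (2 * s - 1) / Real.log (n : ℝ) ^ 12 →
        ∃ l : AffineSubspace ℝ Plane, IsLine l ∧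
          K * ((n : ℝ) ^ s / Real.log (n : ℝ) ^ 4) ≤ (pointsOn l P : ℝ) := by
  have hlog2 : 0 < Real.log 2 := Real.log_pos one_lt_two
  -- With `y = n ^ s`, the terms to beat are `n ≤ 3/4 * n * y`, `n * y / 20` from the directions and
  -- `n * y / 10` from `n ^ 2 / R`. The remaining `n * y / 10` is at most `40 * n * pointsOn l P`,
  -- whence `400`.
  refine ⟨Real.log 2 ^ 12 / 10 ^ 6, by positivity, Real.log 2 ^ 4 / 400, by positivity, ?_⟩
  intro n s P G hn hP hs hG hGc hdir
  have hn2 : (2 : ℝ) ≤ n := by exact_mod_cast hn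
  have hn0 : (0 : ℝ) < n := by linarith
  have hlog : Real.log 2 ≤ Real.log n := Real.log_le_log two_pos hn2
  have hlogn : 0 < Real.log n := hlog2.trans_le hlog
  set y : ℝ := (n : ℝ) ^ s with hy
  have hy0 : 0 < y := Real.rpow_pos_of_pos hn0 _
  have h1s : (n : ℝ) ^ (1 + s) = n * y := by rw [Real.rpow_add hn0, Real.rpow_one]
  have h2s : (n : ℝ) ^ (2 * s - 1) = y ^ 2 / n := by
    rw [Real.rpow_sub hn0, Real.rpow_one, two_mul, Real.rpow_add hn0, sq]
  rw [h1s] at hGc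
  rw [h2s] at hdir
  have hy43 : 4 / 3 ≤ y := by
    have h1 : (2 : ℝ) ^ (1 / 2 : ℝ) ≤ y :=
      (Real.rpow_le_rpow two_pos.le hn2 (by norm_num)).trans
        (Real.rpow_le_rpow_of_exponent_le (by linarith) hs)
    rw [← Real.sqrt_eq_rpow] at h1
    exact (Real.le_sqrt' (by norm_num)).2 (by norm_num) |>.trans h1
  have hyn : y ≤ n := by
    have h1 : G.card ≤ n * n := by
      rw [← hP, ← Finset.card_product]
      exact Finset.card_le_card hG
    have h2 : (G.card : ℝ) ≤ n * n := by exact_mod_cast h1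
    exact le_of_mul_le_mul_left (hGc.trans h2) hn0
  have hPG : P.card < G.card := by
    rw [hP]
    have : (n : ℝ) < G.card := by nlinarith
    exact_mod_cast this
  set R := ⌈32000 * n / y⌉₊ with hR
  have hny : 1 ≤ n / y := (one_le_div hy0).2 hyn
  have hR1 : 32000 * n / y ≤ R := Nat.le_ceil _
  have hR2 : (R : ℝ) ≤ 32001 * (n / y) := by
    have := (Nat.ceil_lt_add_one (a := 32000 * n / y) (by positivity)).le
    rw [mul_div_assoc] at this
    rw [hR, mul_div_assoc]
    linarith
  have hRpos : 0 < (R : ℝ) := lt_of_lt_of_le (by positivity) hR1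
  obtain ⟨l, hl, hle⟩ := exists_rich_line hG hPG (R := R) (by exact_mod_cast hRpos)
  refine ⟨l, hl, ?_⟩
  rw [hP] at hle
  have e1 : (R : ℝ) * (n * (directions G).ncard) ≤ n * y / 20 := by
    have hd : ((directions G).ncard : ℝ) ≤ y ^ 2 / n / 10 ^ 6 := by
      refine hdir.trans ?_
      rw [div_le_iff₀ (by positivity)]
      have : Real.log 2 ^ 12 ≤ Real.log n ^ 12 := by gcongr
      calc Real.log 2 ^ 12 / 10 ^ 6 * (y ^ 2 / n) = y ^ 2 / n / 10 ^ 6 * Real.log 2 ^ 12 := by ring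
        _ ≤ _ := by gcongr
    calc (R : ℝ) * (n * (directions G).ncard) ≤ 32001 * (n / y) * (n * (y ^ 2 / n / 10 ^ 6)) := by
          gcongr
      _ = n * y * (32001 / 10 ^ 6) := by field_simp
      _ ≤ n * y / 20 := by
          have : 0 < n * y := by positivity
          linarith
  have e2 : 3200 * (n : ℝ) ^ 2 / R ≤ n * y / 10 := by
    rw [div_le_iff₀ hRpos]
    calc 3200 * (n : ℝ) ^ 2 = n * y / 10 * (32000 * n / y) := by field_simp; norm_num
      _ ≤ _ := by gcongr
  have e3 : (n : ℝ) ≤ 3 / 4 * (n * y) := by nlinarith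
  have e4 : y / 400 ≤ pointsOn l P := by
    have : (n : ℝ) * (y / 400) ≤ n * pointsOn l P := by linarith
    exact le_of_mul_le_mul_left this hn0
  refine le_trans ?_ e4
  have : Real.log 2 ^ 4 ≤ Real.log n ^ 4 := by gcongr
  rw [mul_div_assoc', div_le_iff₀ (by positivity)]
  calc Real.log 2 ^ 4 / 400 * y = y / 400 * Real.log 2 ^ 4 := by ring
    _ ≤ _ := by gcongr

/-! ### Grids, and the example with long rows -/

/-- The point with natural coordinates `x` and `y`. -/
noncomputable def gridPoint (x y : ℕ) : Plane := !₂[(x : ℝ), (y : ℝ)]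

@[simp] theorem gridPoint_zero (x y : ℕ) : gridPoint x y 0 = x := rfl

@[simp] theorem gridPoint_one (x y : ℕ) : gridPoint x y 1 = y := rfl

theorem gridPoint_inj {x y x' y' : ℕ} : gridPoint x y = gridPoint x' y' ↔ x = x' ∧ y = y' := by
  refine ⟨fun h => ⟨?_, ?_⟩, by rintro ⟨rfl, rfl⟩; rfl⟩
  · have h' : ((x : ℕ) : ℝ) = (x' : ℕ) := congrArg (fun p : Plane => p 0) h
    exact_mod_cast h'
  · have h' : ((y : ℕ) : ℝ) = (y' : ℕ) := congrArg (fun p : Plane => p 1) h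
    exact_mod_cast h'

open Classical in
/-- The first `n` points of `{0, …, k - 1} × ℕ`, row by row. -/
noncomputable def grid (k n : ℕ) : Finset Plane :=
  (Finset.range n).image fun i => gridPoint (i % k) (i / k)

theorem card_grid (k n : ℕ) : (grid k n).card = n := by
  rw [grid, Finset.card_image_of_injOn, Finset.card_range]
  intro i _ j _ hij
  obtain ⟨h1, h2⟩ := gridPoint_inj.1 hij
  rw [← Nat.mod_add_div i k, ← Nat.mod_add_div j k, h1, h2]

theorem gridPoint_mem_grid {k n x y : ℕ} (hx : x < k) (h : x + k * y < n) :
    gridPoint x y ∈ grid k n := by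
  refine Finset.mem_image.2 ⟨x + k * y, Finset.mem_range.2 h, ?_⟩
  rw [gridPoint_inj, Nat.add_mul_mod_self_left, Nat.add_mul_div_left _ _ (by omega),
    Nat.mod_eq_of_lt hx, Nat.div_eq_of_lt hx, zero_add]
  exact ⟨rfl, rfl⟩

theorem exists_of_mem_grid {k n : ℕ} (hk : 0 < k) {p : Plane} (hp : p ∈ grid k n) :
    ∃ x y : ℕ, p = gridPoint x y ∧ x < k ∧ y ≤ n / k := by
  obtain ⟨i, hi, rfl⟩ := Finset.mem_image.1 hp
  exact ⟨i % k, i / k, rfl, Nat.mod_lt _ hk, Nat.div_le_div_right (Finset.mem_range.1 hi).le⟩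

/-- A direction vector has a nonzero coordinate. Hence a line meets a grid in at most as many points
as there are columns or rows. -/
theorem IsLine.injOn_or {l : AffineSubspace ℝ Plane} (hl : IsLine l) :
    Set.InjOn (fun p : Plane => p 0) (l : Set Plane) ∨
      Set.InjOn (fun p : Plane => p 1) (l : Set Plane) := by
  obtain ⟨⟨v, hvl⟩, hv, hspan⟩ := finrank_eq_one_iff'.1 hl
  have key : ∀ p ∈ l, ∀ q ∈ l, ∃ c : ℝ, c • v = p - q := by
    intro p hp q hq
    obtain ⟨c, hc⟩ := hspan ⟨p -ᵥ q, AffineSubspace.vsub_mem_direction hp hq⟩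
    exact ⟨c, congrArg Subtype.val hc⟩
  have hinj : ∀ i : Fin 2, v i ≠ 0 → Set.InjOn (fun p : Plane => p i) (l : Set Plane) := by
    intro i hi p hp q hq hpq
    obtain ⟨c, hc⟩ := key p hp q hq
    have h1 : c * v i = p i - q i := congrArg (fun w : Plane => w i) hc
    rw [sub_eq_zero.2 hpq] at h1
    have hc0 : c = 0 := (mul_eq_zero.1 h1).resolve_right hi
    rw [hc0, zero_smul] at hc
    exact (sub_eq_zero.1 hc.symm)
  by_cases h0 : v 0 = 0
  · refine Or.inr (hinj 1 fun h1 => hv ?_)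
    rw [Submodule.mk_eq_zero]
    ext i
    fin_cases i <;> assumption
  · exact Or.inl (hinj 0 h0)

theorem pointsOn_grid_le {l : AffineSubspace ℝ Plane} (hl : IsLine l) {k n : ℕ} (hk : 0 < k) :
    pointsOn l (grid k n) ≤ max k (n / k + 1) := by
  classical
  have key : ∀ (i : Fin 2) (N : ℕ), Set.InjOn (fun p : Plane => p i) (l : Set Plane) →
      (∀ p ∈ grid k n, ∃ x < N, p i = x) → pointsOn l (grid k n) ≤ N := by
    intro i N hinj hN
    have h1 : pointsOn l (grid k n) ≤
        (((Finset.range N).image (Nat.cast : ℕ → ℝ) : Finset ℝ) : Set ℝ).ncard := by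
      refine Set.ncard_le_ncard_of_injOn (fun p : Plane => p i) ?_
        (hinj.mono Set.inter_subset_left) (Finset.finite_toSet _)
      rintro p ⟨-, hp⟩
      obtain ⟨x, hx, hpx⟩ := hN p hp
      exact Finset.mem_image.2 ⟨x, Finset.mem_range.2 hx, hpx.symm⟩
    rw [Set.ncard_coe_finset] at h1
    exact h1.trans (Finset.card_image_le.trans (Finset.card_range N).le)
  rcases hl.injOn_or with h | h
  · refine (key 0 k h fun p hp => ?_).trans (le_max_left _ _)
    obtain ⟨x, y, rfl, hx, hy⟩ := exists_of_mem_grid hk hp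
    exact ⟨x, hx, rfl⟩
  · refine (key 1 (n / k + 1) h fun p hp => ?_).trans (le_max_right _ _)
    obtain ⟨x, y, rfl, hx, hy⟩ := exists_of_mem_grid hk hp
    exact ⟨y, Nat.lt_succ_of_le hy, rfl⟩

theorem pointsOn_le_card (l : AffineSubspace ℝ Plane) (P : Finset Plane) :
    pointsOn l P ≤ P.card := by
  rw [pointsOn, ← Set.ncard_coe_finset]
  exact Set.ncard_le_ncard Set.inter_subset_right P.finite_toSet

theorem inv_norm_smul_smul {c : ℝ} (hc : 0 < c) (v : Plane) :
    ‖c • v‖⁻¹ • (c • v) = ‖v‖⁻¹ • v := by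
  rw [norm_smul, Real.norm_of_nonneg hc.le, smul_smul, mul_inv, mul_right_comm,
    inv_mul_cancel₀ hc.ne', one_mul]

/-- If all differences along pairs in `G` are positive multiples of vectors in `T`, then there
are at most `#T` directions. -/
theorem ncard_directions_le {G : Finset (Plane × Plane)} {T : Finset Plane}
    (h : ∀ x ∈ G, x.1 ≠ x.2 → ∃ v ∈ T, ∃ c : ℝ, 0 < c ∧ x.1 - x.2 = c • v) :
    (directions G).ncard ≤ T.card := by
  classical
  have hsub : directions G ⊆ (T.image fun v => ‖v‖⁻¹ • v : Finset Plane) := by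
    rintro e ⟨p, q, hpq, hne, rfl⟩
    obtain ⟨v, hv, c, hc, hvc⟩ := h (p, q) hpq hne
    simp only at hvc
    refine Finset.mem_image.2 ⟨v, hv, ?_⟩
    rw [hvc, inv_norm_smul_smul hc]
  refine (Set.ncard_le_ncard hsub (Finset.finite_toSet _)).trans ?_
  rw [Set.ncard_coe_finset]
  exact Finset.card_image_le

/-- Every point in the left half of a full row is paired with every point in its right half; this
order makes all the directions equal. -/
theorem exists_rows (n h : ℕ) :
    ∃ G ⊆ grid (2 * h) n ×ˢ grid (2 * h) n, G.card = n / (2 * h) * h * h ∧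
      (directions G).ncard ≤ 1 := by
  classical
  let f : (ℕ × ℕ) × ℕ → Plane × Plane := fun x =>
    (gridPoint x.1.2 x.1.1, gridPoint (h + x.2) x.1.1)
  refine ⟨((Finset.range (n / (2 * h)) ×ˢ Finset.range h) ×ˢ Finset.range h).image f, ?_, ?_, ?_⟩
  · intro e he
    obtain ⟨⟨⟨y, a⟩, b⟩, hx, rfl⟩ := Finset.mem_image.1 he
    simp only [Finset.mem_product, Finset.mem_range] at hx
    obtain ⟨⟨hy, ha⟩, hb⟩ := hx
    have h1 : 2 * h * (y + 1) ≤ n :=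
      (Nat.mul_le_mul_left _ hy).trans (Nat.mul_div_le n (2 * h))
    rw [mul_add, mul_one] at h1
    exact Finset.mem_product.2 ⟨gridPoint_mem_grid (by simp only; omega) (by simp only; omega),
      gridPoint_mem_grid (by simp only; omega) (by simp only; omega)⟩
  · rw [Finset.card_image_of_injective, Finset.card_product, Finset.card_product,
      Finset.card_range, Finset.card_range]
    rintro ⟨⟨y, a⟩, b⟩ ⟨⟨y', a'⟩, b'⟩ he
    simp only [f, Prod.mk.injEq, gridPoint_inj] at he ⊢
    omega
  · refine (ncard_directions_le (T := {!₂[-1, 0]}) fun e he _ => ?_).trans (by simp)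
    obtain ⟨⟨⟨y, a⟩, b⟩, hx, rfl⟩ := Finset.mem_image.1 he
    simp only [Finset.mem_product, Finset.mem_range] at hx
    obtain ⟨⟨hy, ha⟩, hb⟩ := hx
    have ha' : (a : ℝ) < h := by exact_mod_cast ha
    refine ⟨_, Finset.mem_singleton_self _, (h : ℝ) + b - a, ?_, ?_⟩
    · have : (0 : ℝ) ≤ b := Nat.cast_nonneg _
      linarith
    · ext i
      fin_cases i <;> simp [f]

theorem few_directions_sharp :
    ∃ C : ℝ, 0 < C ∧
      ∀ s t : ℝ, 1 / 2 < s → s ≤ 1 → 0 ≤ t → t < 2 * s - 1 → (s = 1 → 0 < t) →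
        ∀ᶠ n : ℕ in Filter.atTop, ∃ (P : Finset Plane) (G : Finset (Plane × Plane)),
          P.card = n ∧ G ⊆ P ×ˢ P ∧
          (n : ℝ) ^ (1 + s) ≤ (G.card : ℝ) ∧
          ((directions G).ncard : ℝ) ≤ (n : ℝ) ^ t ∧
          ∀ l : AffineSubspace ℝ Plane, IsLine l → (pointsOn l P : ℝ) ≤ C * (n : ℝ) ^ s := by
  refine ⟨22, by norm_num, fun s t hs hs1 ht _ hst => ?_⟩
  rcases hs1.eq_or_lt with rfl | hs1
  -- For `s = 1` all ordered pairs are needed; points on a single row give two opposite directions,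
  -- and `n ^ t ≥ 2` needs `t > 0`.
  · have h2 : ∀ᶠ n : ℕ in Filter.atTop, (2 : ℝ) ≤ (n : ℝ) ^ t :=
      ((tendsto_rpow_atTop (hst rfl)).comp tendsto_natCast_atTop_atTop).eventually_ge_atTop 2
    filter_upwards [h2, Filter.eventually_ge_atTop 1] with n hn hn1
    refine ⟨grid n n, grid n n ×ˢ grid n n, card_grid n n, subset_rfl, ?_, ?_, ?_⟩
    · rw [Finset.card_product, card_grid, one_add_one_eq_two, Real.rpow_two, sq]
      push_cast
      rfl
    · refine le_trans ?_ hn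
      have : (directions (grid n n ×ˢ grid n n)).ncard ≤
          ({!₂[-1, 0], !₂[1, 0]} : Finset Plane).card := by
        refine ncard_directions_le fun e he hne => ?_
        obtain ⟨hp, hq⟩ := Finset.mem_product.1 he
        obtain ⟨p, q⟩ := e
        obtain ⟨i, hi, rfl⟩ := Finset.mem_image.1 hp
        obtain ⟨j, hj, rfl⟩ := Finset.mem_image.1 hq
        rw [Finset.mem_range] at hi hj
        simp only [Nat.mod_eq_of_lt hi, Nat.mod_eq_of_lt hj, Nat.div_eq_of_lt hi,
          Nat.div_eq_of_lt hj, ne_eq, gridPoint_inj, and_true] at hne ⊢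
        rcases lt_or_gt_of_ne hne with h | h
        · refine ⟨!₂[-1, 0], by simp, (j : ℝ) - i, sub_pos.2 (by exact_mod_cast h), ?_⟩
          ext i
          fin_cases i <;> simp
        · refine ⟨!₂[1, 0], by simp, (i : ℝ) - j, sub_pos.2 (by exact_mod_cast h), ?_⟩
          ext i
          fin_cases i <;> simp
      exact_mod_cast this.trans Finset.card_le_two
    · intro l _
      have h1 : (pointsOn l (grid n n) : ℝ) ≤ n := by
        exact_mod_cast (pointsOn_le_card l (grid n n)).trans (card_grid n n).le
      rw [Real.rpow_one]
      have : (0 : ℝ) ≤ n := Nat.cast_nonneg _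
      linarith
  · have h2 : ∀ᶠ n : ℕ in Filter.atTop, (22 : ℝ) ≤ (n : ℝ) ^ (1 - s) :=
      ((tendsto_rpow_atTop (sub_pos.2 hs1)).comp
        tendsto_natCast_atTop_atTop).eventually_ge_atTop 22
    filter_upwards [h2, Filter.eventually_ge_atTop 1] with n hn hn1
    have hn1' : (1 : ℝ) ≤ n := by exact_mod_cast hn1
    have hn0 : (0 : ℝ) < n := by linarith
    set y : ℝ := (n : ℝ) ^ s with hy
    have hy1 : 1 ≤ y := Real.one_le_rpow hn1' (by linarith)
    have hny : (n : ℝ) ^ (1 - s) = n / y := by rw [Real.rpow_sub hn0, Real.rpow_one]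
    have hnyy : (n : ℝ) / y ≤ y := by
      rw [← hny]
      exact Real.rpow_le_rpow_of_exponent_le hn1' (by linarith)
    rw [hny, le_div_iff₀ (by linarith)] at hn
    -- Full rows give at least `n * h / 4 ≥ n * y` pairs, and a row has `2 * h ≤ 22 * y ≤ n` points.
    set h := ⌈10 * y⌉₊ with hh
    have hh1 : 10 * y ≤ h := Nat.le_ceil _
    have hh2 : (h : ℝ) ≤ 11 * y := by
      have := (Nat.ceil_lt_add_one (a := 10 * y) (by linarith)).le
      linarith
    have hh0 : 0 < h := by
      have : (0 : ℝ) < h := by linarith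
      exact_mod_cast this
    obtain ⟨G, hG, hGc, hGd⟩ := exists_rows n h
    refine ⟨grid (2 * h) n, G, card_grid _ _, hG, ?_, ?_, ?_⟩
    · have h3 : 2 * h ≤ n := by
        have : (2 : ℝ) * h ≤ n := by linarith
        exact_mod_cast this
      have h4 : n ≤ 4 * h * (n / (2 * h)) := by
        have h5 := Nat.lt_mul_div_succ n (by omega : 0 < 2 * h)
        have h6 : 1 ≤ n / (2 * h) := (Nat.one_le_div_iff (by omega)).2 h3
        nlinarith
      have h5 : (n : ℝ) ≤ 4 * h * (n / (2 * h) : ℕ) := by exact_mod_cast h4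
      rw [hGc, Real.rpow_add hn0, Real.rpow_one, ← hy]
      push_cast
      have h6 : (n : ℝ) * h ≤ 4 * h * (n / (2 * h) : ℕ) * h := by gcongr
      have h7 : (n : ℝ) * (10 * y) ≤ n * h := by gcongr
      have h8 : (0 : ℝ) ≤ n * y := by positivity
      nlinarith
    · have h3 : ((directions G).ncard : ℝ) ≤ 1 := by exact_mod_cast hGd
      exact h3.trans (Real.one_le_rpow hn1' ht)
    · intro l hl
      have h3 : (pointsOn l (grid (2 * h) n) : ℝ) ≤
          max ((2 * h : ℕ) : ℝ) ((n / (2 * h) + 1 : ℕ) : ℝ) := by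
        exact_mod_cast pointsOn_grid_le hl (by omega)
      refine h3.trans (max_le ?_ ?_)
      · push_cast
        linarith
      · have h4 : ((n / (2 * h) : ℕ) : ℝ) ≤ (n : ℝ) / (2 * h : ℕ) := Nat.cast_div_le
        have h5 : (n : ℝ) / (2 * h : ℕ) ≤ n / y := by
          gcongr
          push_cast
          linarith
        push_cast at h4 h5 ⊢
        linarith

/-! ### Primitive vectors and the example in a square grid -/

/-- Pairs with a common divisor `d ≥ 2` number at most the sum of `(D / d) ^ 2`, and the inverse
squares from `2` on sum to at most `1/4 + 1/2`. -/
theorem sq_le_four_mul_card_coprime (D : ℕ) :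
    D ^ 2 ≤ 4 * ((Finset.Ioc 0 D ×ˢ Finset.Ioc 0 D).filter fun x => Nat.Coprime x.1 x.2).card := by
  classical
  set A := (Finset.Ioc 0 D ×ˢ Finset.Ioc 0 D).filter fun x => Nat.Coprime x.1 x.2
  set B := (Finset.Ioc 0 D ×ˢ Finset.Ioc 0 D).filter fun x => ¬ Nat.Coprime x.1 x.2
  have hAB : A.card + B.card = D ^ 2 := by
    rw [Finset.card_filter_add_card_filter_not, Finset.card_product, Nat.card_Ioc, sq]
    simp
  have hB : B.card ≤ ∑ d ∈ Finset.Ioc 1 D, (D / d) ^ 2 := by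
    have hsub : B ⊆ (Finset.Ioc 1 D).biUnion fun d =>
        (Finset.Ioc 0 D).filter (d ∣ ·) ×ˢ (Finset.Ioc 0 D).filter (d ∣ ·) := by
      intro x hx
      obtain ⟨hx, hc⟩ := Finset.mem_filter.1 hx
      obtain ⟨h1, h2⟩ := Finset.mem_product.1 hx
      have h1' := Finset.mem_Ioc.1 h1
      have h0 : 0 < Nat.gcd x.1 x.2 := Nat.gcd_pos_of_pos_left _ h1'.1
      have hle : Nat.gcd x.1 x.2 ≤ x.1 := Nat.gcd_le_left _ h1'.1
      refine Finset.mem_biUnion.2 ⟨Nat.gcd x.1 x.2, Finset.mem_Ioc.2 ⟨?_, hle.trans h1'.2⟩, ?_⟩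
      · exact lt_of_le_of_ne h0 (Ne.symm hc)
      · simp only [Finset.mem_product, Finset.mem_filter]
        exact ⟨⟨h1, Nat.gcd_dvd_left _ _⟩, ⟨h2, Nat.gcd_dvd_right _ _⟩⟩
    refine (Finset.card_le_card hsub).trans (Finset.card_biUnion_le.trans ?_)
    refine Finset.sum_le_sum fun d _ => ?_
    rw [Finset.card_product, Nat.Ioc_filter_dvd_card_eq_div, sq]
  have hsum : ∑ d ∈ Finset.Ioc 1 D, ((d : ℝ) ^ 2)⁻¹ ≤ 3 / 4 := by
    rcases le_or_gt D 1 with hD | hD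
    · rw [Finset.Ioc_eq_empty (by omega), Finset.sum_empty]
      norm_num
    · rw [← Finset.insert_Ioc_add_one_left_eq_Ioc hD, Finset.sum_insert (by simp)]
      have h1 := sum_Ioc_inv_sq_le_sub (α := ℝ) (k := 2) (n := D) (by norm_num) hD
      have h2 : (0 : ℝ) ≤ (D : ℝ)⁻¹ := by positivity
      norm_num at h1 ⊢
      linarith
  have hBr : (B.card : ℝ) ≤ 3 / 4 * (D : ℝ) ^ 2 := by
    have h1 : (B.card : ℝ) ≤ ∑ d ∈ Finset.Ioc 1 D, ((D / d : ℕ) : ℝ) ^ 2 := by exact_mod_cast hB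
    have h2 : ∑ d ∈ Finset.Ioc 1 D, ((D / d : ℕ) : ℝ) ^ 2 ≤
        ∑ d ∈ Finset.Ioc 1 D, (D : ℝ) ^ 2 * ((d : ℝ) ^ 2)⁻¹ := by
      refine Finset.sum_le_sum fun d _ => ?_
      rw [← div_eq_mul_inv, ← div_pow]
      gcongr
      exact Nat.cast_div_le
    rw [← Finset.mul_sum] at h2
    have h3 : (D : ℝ) ^ 2 * ∑ d ∈ Finset.Ioc 1 D, ((d : ℝ) ^ 2)⁻¹ ≤ (D : ℝ) ^ 2 * (3 / 4) := by
      gcongr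
    linarith
  have hABr : (A.card : ℝ) + B.card = (D : ℝ) ^ 2 := by exact_mod_cast hAB
  have : (D : ℝ) ^ 2 ≤ 4 * A.card := by linarith
  exact_mod_cast this

/-- The pairs are `(p, p + j v)` with `v` primitive in the box of side `D`, `1 ≤ j ≤ J` and `p` in a
corner square of side `h = k - J * D ≥ k / 2`, so that both points stay in the grid. The direction
depends only on `v`. -/
theorem exists_pairs_in_square {n k D : ℕ} (hk : k * k ≤ n) (hD : 0 < D) (hDk : 2 * D ≤ k) :
    ∃ G ⊆ grid k n ×ˢ grid k n, k ^ 3 * D ≤ 64 * G.card ∧ (directions G).ncard ≤ D ^ 2 := by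
  classical
  set J := k / (2 * D) with hJ
  have hJ0 : 0 < J := Nat.div_pos hDk (by omega)
  have hJ1 : 2 * D * J ≤ k := Nat.mul_div_le k (2 * D)
  have hJ2 : k ≤ 4 * D * J := by
    have := Nat.lt_mul_div_succ k (by omega : 0 < 2 * D)
    rw [← hJ] at this
    nlinarith
  obtain ⟨h, hh⟩ : ∃ h, k = h + J * D := Nat.exists_eq_add_of_le' (by nlinarith)
  have hh2 : k ≤ 2 * h := by nlinarith
  set A := (Finset.Ioc 0 D ×ˢ Finset.Ioc 0 D).filter fun x => Nat.Coprime x.1 x.2 with hA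
  have hAc : D ^ 2 ≤ 4 * A.card := sq_le_four_mul_card_coprime D
  have hAc' : A.card ≤ D ^ 2 := by
    refine (Finset.card_filter_le _ _).trans ?_
    rw [Finset.card_product, Nat.card_Ioc, sq]
    simp
  have hAmem : ∀ x ∈ A, 0 < x.1 ∧ x.1 ≤ D ∧ 0 < x.2 ∧ x.2 ≤ D ∧ Nat.Coprime x.1 x.2 := by
    intro x hx
    simp only [hA, Finset.mem_filter, Finset.mem_product, Finset.mem_Ioc] at hx
    tauto
  let f : ((ℕ × ℕ) × (ℕ × ℕ)) × ℕ → Plane × Plane := fun x =>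
    (gridPoint x.1.1.1 x.1.1.2, gridPoint (x.1.1.1 + x.2 * x.1.2.1) (x.1.1.2 + x.2 * x.1.2.2))
  have hmem : ∀ {x y : ℕ}, x < k → y < k → gridPoint x y ∈ grid k n := by
    intro x y hx hy
    refine gridPoint_mem_grid hx (lt_of_lt_of_le ?_ hk)
    have := Nat.mul_le_mul_left k (Nat.succ_le_of_lt hy)
    rw [Nat.succ_eq_add_one, mul_add] at this
    omega
  refine ⟨(((Finset.range h ×ˢ Finset.range h) ×ˢ A) ×ˢ Finset.Ioc 0 J).image f, ?_, ?_, ?_⟩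
  · intro e he
    obtain ⟨⟨⟨⟨x, y⟩, v⟩, j⟩, hx, rfl⟩ := Finset.mem_image.1 he
    simp only [Finset.mem_product, Finset.mem_range, Finset.mem_Ioc] at hx
    obtain ⟨⟨⟨hx, hy⟩, hv⟩, hj0, hj⟩ := hx
    obtain ⟨-, ha, -, hb, -⟩ := hAmem v hv
    have h1 : j * v.1 ≤ J * D := Nat.mul_le_mul hj ha
    have h2 : j * v.2 ≤ J * D := Nat.mul_le_mul hj hb
    exact Finset.mem_product.2 ⟨hmem (by simp only; omega) (by simp only; omega),
      hmem (by simp only; omega) (by simp only; omega)⟩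
  · rw [Finset.card_image_of_injOn]
    · simp only [Finset.card_product, Finset.card_range, Nat.card_Ioc, Nat.sub_zero]
      calc k ^ 3 * D = k * k * k * D := by ring
        _ ≤ 2 * h * (2 * h) * (4 * D * J) * D := by gcongr
        _ = 16 * (h * h * J) * D ^ 2 := by ring
        _ ≤ 16 * (h * h * J) * (4 * A.card) := by gcongr
        _ = _ := by ring
    · rintro ⟨⟨⟨x, y⟩, ⟨a, b⟩⟩, j⟩ hx ⟨⟨⟨x', y'⟩, ⟨a', b'⟩⟩, j'⟩ hx' he
      simp only [Finset.coe_product, Set.mem_prod, Finset.mem_coe, Finset.mem_Ioc] at hx hx'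
      obtain ⟨⟨-, hv⟩, hj0, -⟩ := hx
      obtain ⟨⟨-, hv'⟩, -, -⟩ := hx'
      have hc : Nat.gcd a b = 1 := (hAmem _ hv).2.2.2.2
      have hc' : Nat.gcd a' b' = 1 := (hAmem _ hv').2.2.2.2
      simp only [f, Prod.mk.injEq, gridPoint_inj] at he
      obtain ⟨⟨rfl, rfl⟩, h1, h2⟩ := he
      have h1' : j * a = j' * a' := by omega
      have h2' : j * b = j' * b' := by omega
      -- As `v` is primitive, `j` is the gcd of the coordinates of the difference.
      have hjj : j = j' := by
        have := Nat.gcd_mul_left j a b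
        rw [h1', h2', Nat.gcd_mul_left, hc, hc'] at this
        omega
      subst hjj
      rw [Nat.eq_of_mul_eq_mul_left hj0 h1', Nat.eq_of_mul_eq_mul_left hj0 h2']
  · refine (ncard_directions_le (T := A.image fun v => -gridPoint v.1 v.2) fun e he _ => ?_).trans
      (Finset.card_image_le.trans hAc')
    obtain ⟨⟨⟨⟨x, y⟩, v⟩, j⟩, hx, rfl⟩ := Finset.mem_image.1 he
    simp only [Finset.mem_product, Finset.mem_Ioc] at hx
    refine ⟨_, Finset.mem_image_of_mem _ hx.1.2, j, by exact_mod_cast hx.2.1, ?_⟩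
    ext i
    fin_cases i <;> simp [f]

theorem ncard_directions_grid_le {k n B : ℕ} (hk : 0 < k) (hkB : k ≤ B) (hnB : n / k ≤ B) :
    (directions (grid k n ×ˢ grid k n)).ncard ≤ (2 * B + 1) ^ 2 := by
  classical
  have hI : (Finset.Icc (-B : ℤ) B).card = 2 * B + 1 := by
    rw [Int.card_Icc]
    omega
  refine (ncard_directions_le (T := (Finset.Icc (-B : ℤ) B ×ˢ Finset.Icc (-B : ℤ) B).image
    fun v => (!₂[(v.1 : ℝ), (v.2 : ℝ)] : Plane)) fun e he _ => ?_).trans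
      (Finset.card_image_le.trans (by rw [Finset.card_product, hI, sq]))
  obtain ⟨p, q⟩ := e
  obtain ⟨hp, hq⟩ := Finset.mem_product.1 he
  obtain ⟨x, y, rfl, hx, hy⟩ := exists_of_mem_grid hk hp
  obtain ⟨x', y', rfl, hx', hy'⟩ := exists_of_mem_grid hk hq
  refine ⟨_, Finset.mem_image_of_mem _ (a := ((x : ℤ) - x', (y : ℤ) - y')) ?_, 1, one_pos, ?_⟩
  · simp only [Finset.mem_product, Finset.mem_Icc]
    omega
  · ext i
    fin_cases i <;> simp

theorem sqrt_collinear_example :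
    ∃ C : ℝ, 0 < C ∧
      ∀ (s : ℝ) (n : ℕ), 1 / 2 ≤ s → s ≤ 1 → 1 ≤ n →
        ∃ (P : Finset Plane) (G : Finset (Plane × Plane)),
          P.card = n ∧ G ⊆ P ×ˢ P ∧
          (n : ℝ) ^ (1 + s) ≤ (G.card : ℝ) ∧
          ((directions G).ncard : ℝ) ≤ C * (n : ℝ) ^ (2 * s - 1) ∧
          ∀ l : AffineSubspace ℝ Plane, IsLine l →
            (pointsOn l P : ℝ) ≤ C * (n : ℝ) ^ (1 / 2 : ℝ) := by
  refine ⟨10 ^ 8, by norm_num, fun s n hs hs1 hn => ?_⟩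
  have hn1 : (1 : ℝ) ≤ n := by exact_mod_cast hn
  have hn0 : (0 : ℝ) < n := by linarith
  set k := n.sqrt with hk
  have hk0 : 0 < k := Nat.sqrt_pos.2 hn
  have hkn : k * k ≤ n := Nat.sqrt_le n
  have hnk : n ≤ k * k + k + k := Nat.sqrt_le_add n
  have hdiv : n / k ≤ k + 2 := by
    refine Nat.div_le_of_le_mul (hnk.trans (le_of_eq ?_))
    ring
  set y : ℝ := (n : ℝ) ^ (s - 1 / 2) with hy
  set r : ℝ := (n : ℝ) ^ (1 / 2 : ℝ) with hr
  have hy1 : 1 ≤ y := Real.one_le_rpow hn1 (by linarith)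
  have hr0 : 0 < r := Real.rpow_pos_of_pos hn0 _
  have hr2 : r * r = n := by
    rw [hr, ← Real.rpow_add hn0]
    norm_num
  have hkr : (k : ℝ) ≤ r := by
    have : (k : ℝ) * k ≤ n := by exact_mod_cast hkn
    exact (mul_self_le_mul_self_iff (Nat.cast_nonneg _) hr0.le).2 (this.trans hr2.ge)
  have hrk : r ≤ 2 * k := by
    have h1 : (n : ℝ) ≤ 2 * k * (2 * k) := by
      have : n ≤ 2 * k * (2 * k) := by nlinarith
      exact_mod_cast this
    exact (mul_self_le_mul_self_iff hr0.le (by positivity)).2 (hr2.le.trans h1)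
  have h2s : (n : ℝ) ^ (2 * s - 1) = y ^ 2 := by
    rw [hy, ← Real.rpow_natCast, ← Real.rpow_mul hn0.le]
    congr 1
    push_cast
    ring
  have h1s : (n : ℝ) ^ (1 + s) = r * r * r * y := by
    rw [hr2, hr, hy, mul_assoc, ← Real.rpow_add hn0]
    nth_rewrite 2 [← Real.rpow_one (n : ℝ)]
    rw [← Real.rpow_add hn0]
    congr 1
    ring
  have hline : ∀ l : AffineSubspace ℝ Plane, IsLine l →
      (pointsOn l (grid k n) : ℝ) ≤ 10 ^ 8 * r := by
    intro l hl
    have h1 : pointsOn l (grid k n) ≤ 4 * k :=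
      (pointsOn_grid_le hl hk0).trans (max_le (by omega) (by omega))
    have h2 : (pointsOn l (grid k n) : ℝ) ≤ 4 * k := by exact_mod_cast h1
    linarith
  -- The factor is `64` from the pair count times `8` from `r ≤ 2 * k` cubed.
  set D := ⌈512 * y⌉₊ with hD
  have hD1 : 512 * y ≤ D := Nat.le_ceil _
  have hD2 : (D : ℝ) ≤ 513 * y := by
    have := (Nat.ceil_lt_add_one (a := 512 * y) (by linarith)).le
    linarith
  have hD0 : 0 < D := by
    have : (0 : ℝ) < D := by linarith
    exact_mod_cast this
  rw [h1s, h2s]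
  rcases le_or_gt (2 * D) k with hDk | hDk
  · obtain ⟨G, hG, hGc, hGd⟩ := exists_pairs_in_square hkn hD0 hDk
    refine ⟨grid k n, G, card_grid k n, hG, ?_, ?_, hline⟩
    · have h1 : (k : ℝ) ^ 3 * D ≤ 64 * G.card := by exact_mod_cast hGc
      have h2 : r * r * r * (512 * y) ≤ 2 * k * (2 * k) * (2 * k) * D := by gcongr
      linarith
    · have h1 : ((directions G).ncard : ℝ) ≤ (D : ℝ) ^ 2 := by exact_mod_cast hGd
      have h2 : (D : ℝ) ^ 2 ≤ (513 * y) ^ 2 := by gcongr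
      nlinarith
  -- Here `k < 2 * D`, so even all pairs of the grid span at most a constant times `D ^ 2`
  -- directions.
  · refine ⟨grid k n, grid k n ×ˢ grid k n, card_grid k n, subset_rfl, ?_, ?_, hline⟩
    · rw [Finset.card_product, card_grid, ← h1s]
      push_cast
      rw [← sq, ← Real.rpow_two]
      exact Real.rpow_le_rpow_of_exponent_le hn1 (by linarith)
    · have h1 := ncard_directions_grid_le (n := n) (B := k + 2) hk0 (by omega) hdiv
      have h2 : (2 * (k + 2) + 1) ^ 2 ≤ (14 * D) ^ 2 := Nat.pow_le_pow_left (by omega) 2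
      have h3 : ((directions (grid k n ×ˢ grid k n)).ncard : ℝ) ≤ (14 * D) ^ 2 := by
        exact_mod_cast h1.trans h2
      have h4 : (14 * (D : ℝ)) ^ 2 ≤ (14 * (513 * y)) ^ 2 := by gcongr
      nlinarith

theorem theorem2p1 :
    -- many pairs spanning few directions force many points on a line
    (∃ c : ℝ, 0 < c ∧ ∃ K : ℝ, 0 < K ∧
      ∀ (n : ℕ) (s : ℝ) (P : Finset Plane) (G : Finset (Plane × Plane)),
        2 ≤ n → P.card = n → 1 / 2 ≤ s → G ⊆ P ×ˢ P →
        (n : ℝ) ^ (1 + s) ≤ (G.card : ℝ) →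
        ((directions G).ncard : ℝ) ≤ c * (n : ℝ) ^ (2 * s - 1) / Real.log (n : ℝ) ^ 12 →
        ∃ l : AffineSubspace ℝ Plane, IsLine l ∧
          K * ((n : ℝ) ^ s / Real.log (n : ℝ) ^ 4) ≤ (pointsOn l P : ℝ)) ∧
    -- a stronger bound on the number of directions does not improve the conclusion
    (∃ C : ℝ, 0 < C ∧
      ∀ s t : ℝ, 1 / 2 < s → s ≤ 1 → 0 ≤ t → t < 2 * s - 1 → (s = 1 → 0 < t) →
        ∀ᶠ n : ℕ in Filter.atTop, ∃ (P : Finset Plane) (G : Finset (Plane × Plane)),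
          P.card = n ∧ G ⊆ P ×ˢ P ∧
          (n : ℝ) ^ (1 + s) ≤ (G.card : ℝ) ∧
          ((directions G).ncard : ℝ) ≤ (n : ℝ) ^ t ∧
          ∀ l : AffineSubspace ℝ Plane, IsLine l → (pointsOn l P : ℝ) ≤ C * (n : ℝ) ^ s) ∧
    -- without the logarithms and the small constant one gets at best `n ^ (1 / 2)` points
    (∃ C : ℝ, 0 < C ∧
      ∀ (s : ℝ) (n : ℕ), 1 / 2 ≤ s → s ≤ 1 → 1 ≤ n →
        ∃ (P : Finset Plane) (G : Finset (Plane × Plane)),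
          P.card = n ∧ G ⊆ P ×ˢ P ∧
          (n : ℝ) ^ (1 + s) ≤ (G.card : ℝ) ∧
          ((directions G).ncard : ℝ) ≤ C * (n : ℝ) ^ (2 * s - 1) ∧
          ∀ l : AffineSubspace ℝ Plane, IsLine l →
            (pointsOn l P : ℝ) ≤ C * (n : ℝ) ^ (1 / 2 : ℝ)) :=
  ⟨exists_line_of_few_directions, few_directions_sharp, sqrt_collinear_example⟩
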